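/- Let $d\ge 1$, $m>0$, $L\ge 0$, and let $U:\mathbb{R}^d\to\mathbb{R}$ be continuously differentiable with, for all $x,y\in\mathbb{R}^d$, $$\|\nabla U(x)-\nabla U(y)\|\le L\|x-y\|,\qquad U(y)\ge U(x)+\langle\nabla U(x),y-x\rangle+\tfrac m2\|x-y\|^2 .$$ Let $\kappa=\frac{2mL}{m+L}$ and let $\pi$ be the probability measure with density $e^{-U}/\int_{\mathbb{R}^d} e^{-U(y)}\,dy$. Let $(\gamma_k)_{k\ge1}$ be a nonincreasing sequence of positive reals with $\gamma_1\le 2/(m+L)$, and put $\Gamma_{n,p}=\sum_{k=n}^p\gamma_k$. For $\gamma>0$ let $R_\gamma$ be the Markov kernel $$R_\gamma(x,A)=\int_A(4\pi\gamma)^{-d/2}\exp\!\Big(-\tfrac1{4\gamma}\|y-x+\gamma\nabla U(x)\|^2\Big)dy ,$$ where in this formula $\pi$ denotes the number; for $1\le n\le p$ let $Q^{n,p}=R_{\gamma_n}\cdots R_{\gamma_p}$, let $Q^{n,p}$ be the identity kernel if $p<n$ or $n=p=0$, and let $Q^{0,p}=Q^{1,p}$ for $p\geq 1$. Let $f:\mathbb{R}^d\to\mathbb{R}$,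 and suppose that there are a continuous function $\ell:\mathbb{R}^d\to[0,\infty)$, constants $\varepsilon>0$, $C_\pi>0$, and continuous functions $C_Q,C_{Q,\varepsilon}:\mathbb{R}^d\to[0,\infty)$ such that for all $x,y\in\mathbb{R}^d$ $$|f(y)-f(x)|\le\|y-x\|\max\{\ell(x),\ell(y)\},\qquad \int \ell^2\,d\pi\le C_\pi,$$ $$\sup_{p\ge n\ge0}\int \ell(z)^2\,Q^{n,p}(x,dz)\le C_Q(x),\qquad \sup_{p\ge n\ge0}\int \ell(z)^{2(1+\varepsilon)}\,Q^{n,p}(x,dz)\le C_{Q,\varepsilon}(x).$$ For $x\in\mathbb{R}^d$ let $X_0=x$ and $X_{k+1}=X_k-\gamma_{k+1}\nabla U(X_k)+\sqrt{2\gamma_{k+1}}\,Z_{k+1}$ for $k\geq 0$, where $(Z_k)_{k\ge1}$ are i.i.d. standard Gaussian vectors in $\mathbb{R}^d$ (the unadjusted Langevin algorithm). For $N\ge0$ and $n\ge1$ define $$\hat\pi_n^N(f)=\sum_{k=N+1}^{N+n}\frac{\gamma_{k+1}}{\Gamma_{N+2,N+n+1}}\,f(X_k).$$ Then for all $x\in\mathbb{R}^d$,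 $N\ge0$ and $n\ge1$, $\hat\pi_n^N(f)$ is square-integrable and $$\operatorname{Var}\big(\hat\pi_n^N(f)\big)\le\frac{8\,C_Q(x)}{\kappa^2\,\Gamma_{N+2,N+n+1}}\Big\{1+\Gamma_{N+2,N+n+1}^{-1}\Big(\kappa^{-1}+\frac{2}{m+L}\Big)\Big\}.$$ -/

import Mathlib

open MeasureTheory ProbabilityTheory
open scoped ENNReal Gradient

namespace ULA

/-- The target distribution `π`, with density `x ↦ exp (-U x) / ∫ exp (-U y) dy`
with respect to Lebesgue measure. -/
noncomputable def target {d : ℕ} (U : EuclideanSpace ℝ (Fin d) → ℝ) :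
    Measure (EuclideanSpace ℝ (Fin d)) :=
  volume.withDensity fun x =>
    ENNReal.ofReal (Real.exp (-U x)) / ∫⁻ y, ENNReal.ofReal (Real.exp (-U y))

/-- `y ↦ (4πγ)^(-d/2) exp (-(4γ)⁻¹ ‖y - x + γ ∇U(x)‖²)`, the transition density of one step of
size `γ` of the unadjusted Langevin algorithm started from `x`. -/
noncomputable def stepDensity {d : ℕ} (U : EuclideanSpace ℝ (Fin d) → ℝ) (γ : ℝ)
    (x y : EuclideanSpace ℝ (Fin d)) : ℝ :=
  (4 * Real.pi * γ) ^ (-(d : ℝ) / 2) * Real.exp (-(4 * γ)⁻¹ * ‖y - x + γ • ∇ U x‖ ^ 2)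

theorem measurable_gradient {d : ℕ} (U : EuclideanSpace ℝ (Fin d) → ℝ) : Measurable (∇ U) :=
  (InnerProductSpace.toDual ℝ (EuclideanSpace ℝ (Fin d))).symm.continuous.measurable.comp
    (measurable_fderiv ℝ U)

theorem measurable_stepDensity {d : ℕ} (U : EuclideanSpace ℝ (Fin d) → ℝ) (γ : ℝ) :
    Measurable (Function.uncurry (stepDensity U γ)) := by
  have h : Measurable fun p : EuclideanSpace ℝ (Fin d) × EuclideanSpace ℝ (Fin d) => ∇ U p.1 :=
    (measurable_gradient U).comp measurable_fst
  unfold stepDensity Function.uncurry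
  fun_prop

/-- The Markov kernel `R_γ(x, A) = ∫_A stepDensity U γ x y dy` (for a step size `γ > 0`). -/
noncomputable def R {d : ℕ} (U : EuclideanSpace ℝ (Fin d) → ℝ) (γ : ℝ) :
    Kernel (EuclideanSpace ℝ (Fin d)) (EuclideanSpace ℝ (Fin d)) where
  toFun x := volume.withDensity fun y => ENNReal.ofReal (stepDensity U γ x y)
  measurable' := by
    refine Measure.measurable_of_measurable_coe _ fun s hs => ?_
    simp_rw [withDensity_apply _ hs]
    exact ((measurable_stepDensity U γ).ennreal_ofReal).lintegral_prod_right'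

/-- `Q^{n,p} = R_{γ_n} ⋯ R_{γ_p}` (the step from `R_{γ_n}` is taken first), and the identity
kernel when `p < n`. The step sizes are `γ_1, γ_2, …`, so `Q^{0,0}` is the identity and
`Q^{0,p} = Q^{1,p}`; the value `γ 0` is never used. -/
noncomputable def Q {d : ℕ} (U : EuclideanSpace ℝ (Fin d) → ℝ) (γ : ℕ → ℝ) (n : ℕ) :
    ℕ → Kernel (EuclideanSpace ℝ (Fin d)) (EuclideanSpace ℝ (Fin d))
  | 0 => Kernel.id
  | p + 1 => if n ≤ p + 1 then (R U (γ (p + 1))) ∘ₖ (Q U γ n p) else Kernel.id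

/-- `U` is continuously differentiable with `L`-Lipschitz gradient. -/
structure GradientLipschitz {d : ℕ} (U : EuclideanSpace ℝ (Fin d) → ℝ) (L : ℝ) : Prop where
  contDiff : ContDiff ℝ 1 U
  nonneg : 0 ≤ L
  lipschitz : ∀ x y, ‖∇ U x - ∇ U y‖ ≤ L * ‖x - y‖

/-- `U` is continuously differentiable and `U y ≥ U x + ⟨∇U x, y - x⟩ + (m/2) ‖x - y‖²`. -/
structure StronglyConvex {d : ℕ} (U : EuclideanSpace ℝ (Fin d) → ℝ) (m : ℝ) : Prop where
  contDiff : ContDiff ℝ 1 U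
  lower_bound : ∀ x y, U x + inner ℝ (∇ U x) (y - x) + m / 2 * ‖x - y‖ ^ 2 ≤ U y

/-- The local Lipschitz and moment assumption on `f`: `lip` is a continuous nonnegative local
Lipschitz modulus of `f`, and `Cπ`, `CQ`, `CQε` bound its moments. -/
structure LocLipMoment {d : ℕ} (U : EuclideanSpace ℝ (Fin d) → ℝ) (γ : ℕ → ℝ)
    (f lip : EuclideanSpace ℝ (Fin d) → ℝ) (ε Cπ : ℝ)
    (CQ CQε : EuclideanSpace ℝ (Fin d) → ℝ) : Prop where
  lip_continuous : Continuous lip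
  lip_nonneg : ∀ x, 0 ≤ lip x
  abs_sub_le : ∀ x y, |f y - f x| ≤ ‖y - x‖ * max (lip x) (lip y)
  ε_pos : 0 < ε
  Cπ_pos : 0 < Cπ
  CQ_continuous : Continuous CQ
  CQ_nonneg : ∀ x, 0 ≤ CQ x
  CQε_continuous : Continuous CQε
  CQε_nonneg : ∀ x, 0 ≤ CQε x
  target_moment : (∫⁻ y, ENNReal.ofReal (lip y ^ 2) ∂(target U)) ≤ ENNReal.ofReal Cπ
  Q_moment : ∀ x, ∀ n p : ℕ, n ≤ p →
    (∫⁻ y, ENNReal.ofReal (lip y ^ 2) ∂(Q U γ n p x)) ≤ ENNReal.ofReal (CQ x)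
  Q_moment_ε : ∀ x, ∀ n p : ℕ, n ≤ p →
    (∫⁻ y, ENNReal.ofReal (lip y ^ (2 * (1 + ε))) ∂(Q U γ n p x)) ≤ ENNReal.ofReal (CQε x)

/-- The unadjusted Langevin algorithm started at `x` and driven by `Z_1, Z_2, …`:
`X_{k+1} = X_k - γ_{k+1} ∇U(X_k) + √(2 γ_{k+1}) Z_{k+1}`. -/
noncomputable def chain {d : ℕ} {Ω : Type*} (U : EuclideanSpace ℝ (Fin d) → ℝ) (γ : ℕ → ℝ)
    (x : EuclideanSpace ℝ (Fin d)) (Z : ℕ → Ω → EuclideanSpace ℝ (Fin d)) :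
    ℕ → Ω → EuclideanSpace ℝ (Fin d)
  | 0 => fun _ => x
  | k + 1 => fun ω => chain U γ x Z k ω - γ (k + 1) • ∇ U (chain U γ x Z k ω)
      + √(2 * γ (k + 1)) • Z (k + 1) ω

/-- `Γ_{n,p} = ∑_{k=n}^p γ_k`. -/
noncomputable def Gam (γ : ℕ → ℝ) (n p : ℕ) : ℝ := ∑ k ∈ Finset.Icc n p, γ k

/-- The weighted average `∑_{k=N+1}^{N+n} ω_k f(X_k)` with `ω_k = γ_{k+1} / Γ_{N+2,N+n+1}`. -/
noncomputable def estimator {d : ℕ} {Ω : Type*} (γ : ℕ → ℝ)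
    (f : EuclideanSpace ℝ (Fin d) → ℝ) (X : ℕ → Ω → EuclideanSpace ℝ (Fin d)) (N n : ℕ) (ω : Ω) :
    ℝ :=
  ∑ k ∈ Finset.Icc (N + 1) (N + n), γ (k + 1) * (Gam γ (N + 2) (N + n + 1))⁻¹ * f (X k ω)

/-- `κ = 2 m L / (m + L)`. -/
noncomputable def kappa (m L : ℝ) : ℝ := 2 * m * L / (m + L)

end ULA

/-! The estimator is a function of the independent standard Gaussian vectors `Z_1, …, Z_{N+n}`, so
its variance is controlled by the Gaussian Poincaré inequality `Var F ≤ E‖∇F‖²`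
(`variance_stdGaussian_le`). To bound the gradient, drive two copies of the algorithm by noises that
differ only in `Z_j`. They agree before time `j`, differ by at most `√(2γ_j)` times the perturbation
at time `j`, and are then contracted, because co-coercivity of `∇U` makes each gradient step
Lipschitz with constant `√(1 - κγ_i)` (`sq_norm_gradientStep_sub_le`). Hence `X_k` has sensitivity
`s k j = √(2γ_j) ∏_{j<i≤k} √(1 - κγ_i)` to `Z_j`. Combining this with the local Lipschitz modulus
and Cauchy–Schwarz gives `Var ≤ C ∑_j (∑_k w_k s_kj)²` (`variance_sum_mul_comp_le`), where `C`
bounds the second moments of the modulus along the chain. The deterministic sum is evaluated by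
telescoping (`sum_sq_sensitivity_le`); the noise before the averaging window produces the `κ⁻¹` in
the bound.

The Poincaré inequality is proved for Lipschitz functions, whereas `f` is only locally Lipschitz. It
is therefore multiplied by a cutoff of radius `R`, at the cost of replacing the modulus `lip` by
`lip + |f| / R`. The `2(1+ε)` moment puts `f(X_k)` in `L²`, so the extra term disappears and the
variances converge as `R → ∞`. -/

namespace ProbabilityTheory

/-! ### Gaussian densities and rotation invariance of the standard Gaussian. -/

section Gaussian

variable {E : Type*} [NormedAddCommGroup E] [InnerProductSpace ℝ E] [FiniteDimensional ℝ E]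
  [MeasurableSpace E] [BorelSpace E]

theorem integrable_exp_neg_mul_sq_norm {b : ℝ} (hb : 0 < b) :
    Integrable fun y : E => Real.exp (-b * ‖y‖ ^ 2) := by
  have h := (GaussianFourier.integrable_cexp_neg_mul_sq_norm_add (V := E) (b := (b : ℂ))
    (by simpa using hb) 0 0).norm
  refine h.congr (Filter.Eventually.of_forall fun y => ?_)
  simp only [Complex.norm_exp]
  congr 1
  norm_cast
  simp

/-- The centred Gaussian density of precision `2 b` is the law of `(2 b)^(-1/2)` times a standard
Gaussian vector. -/
theorem withDensity_gaussian_eq_map_stdGaussian {b : ℝ} (hb : 0 < b) :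
    (volume.withDensity fun y : E => ENNReal.ofReal
      ((Real.pi / b) ^ (-(Module.finrank ℝ E : ℝ) / 2) * Real.exp (-b * ‖y‖ ^ 2))) =
      (stdGaussian E).map fun y => (√(2 * b))⁻¹ • y := by
  have hint : Integrable fun y : E =>
      (Real.pi / b) ^ (-(Module.finrank ℝ E : ℝ) / 2) * Real.exp (-b * ‖y‖ ^ 2) :=
    (integrable_exp_neg_mul_sq_norm hb).const_mul _
  have hfin := isFiniteMeasure_withDensity_ofReal hint.2
  have hprob : IsFiniteMeasure ((stdGaussian E).map fun y => (√(2 * b))⁻¹ • y) := by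
    infer_instance
  refine Measure.ext_of_charFun ?_
  ext t
  have hpos : 0 < Real.pi / b := by positivity
  rw [charFun_map_smul, charFun_stdGaussian, charFun_apply,
    integral_withDensity_eq_integral_toReal_smul (by fun_prop)
      (Filter.Eventually.of_forall fun _ => ENNReal.ofReal_lt_top)]
  have key := GaussianFourier.integral_cexp_neg_mul_sq_norm_add (V := E) (b := (b : ℂ))
    (by simpa using hb) Complex.I t
  have h1 : ∀ y : E, (ENNReal.ofReal ((Real.pi / b) ^ (-(Module.finrank ℝ E : ℝ) / 2) *
      Real.exp (-b * ‖y‖ ^ 2))).toReal • Complex.exp (inner ℝ y t * Complex.I) =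
      (((Real.pi / b) ^ (-(Module.finrank ℝ E : ℝ) / 2) : ℝ) : ℂ) *
        Complex.exp (-b * ‖y‖ ^ 2 + Complex.I * inner ℝ t y) := by
    intro y
    rw [ENNReal.toReal_ofReal (by positivity), Complex.exp_add, Complex.real_smul,
      real_inner_comm]
    push_cast
    ring_nf
  simp_rw [h1]
  rw [integral_const_mul, key, ← mul_assoc]
  have h2 : (((Real.pi / b) ^ (-(Module.finrank ℝ E : ℝ) / 2) : ℝ) : ℂ) *
      (Real.pi / b : ℂ) ^ (Module.finrank ℝ E / 2 : ℂ) = 1 := by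
    have : (Real.pi / b : ℂ) ^ (Module.finrank ℝ E / 2 : ℂ) =
        (((Real.pi / b) ^ ((Module.finrank ℝ E : ℝ) / 2) : ℝ) : ℂ) := by
      rw [Complex.ofReal_cpow hpos.le]
      push_cast
      rfl
    rw [this, ← Complex.ofReal_mul, ← Real.rpow_add hpos]
    simp [neg_div]
  rw [h2, one_mul]
  congr 1
  rw [norm_smul, norm_inv, Real.norm_of_nonneg (Real.sqrt_nonneg _)]
  push_cast
  have hsq : (√(2 * b) : ℂ) ^ 2 = 2 * b := by
    rw [← Complex.ofReal_pow, Real.sq_sqrt (by positivity)]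
    push_cast
    rfl
  rw [mul_pow, inv_pow, hsq, Complex.I_sq]
  have : (b : ℂ) ≠ 0 := by exact_mod_cast hb.ne'
  field_simp
  norm_num

theorem stdGaussian_absolutelyContinuous : stdGaussian E ≪ volume := by
  have h := withDensity_gaussian_eq_map_stdGaussian (E := E) (b := 1 / 2) (by norm_num)
  have h' : (stdGaussian E).map (fun y => (√(2 * (1 / 2) : ℝ))⁻¹ • y) = stdGaussian E := by
    norm_num
  rw [h'] at h
  rw [← h]
  exact withDensity_absolutelyContinuous _ _

/-- Variances of independent Gaussians add; this gives the semigroup law `mehler_mehler`. -/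
theorem map_smul_add_smul_stdGaussian (a b : ℝ) :
    ((stdGaussian E).prod (stdGaussian E)).map (fun p => a • p.1 + b • p.2) =
      (stdGaussian E).map fun y => √(a ^ 2 + b ^ 2) • y := by
  have h1 : (fun p : E × E => a • p.1 + b • p.2) =
      (fun p => p.1 + p.2) ∘ Prod.map (a • ·) (b • ·) := rfl
  have : IsProbabilityMeasure ((stdGaussian E).map (a • ·)) :=
    Measure.isProbabilityMeasure_map (by fun_prop)
  have : IsProbabilityMeasure ((stdGaussian E).map (b • ·)) :=
    Measure.isProbabilityMeasure_map (by fun_prop)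
  rw [h1, ← Measure.map_map (by fun_prop) (by fun_prop), ← Measure.map_prod_map _ _ (by fun_prop)
    (by fun_prop)]
  refine Measure.ext_of_charFun ?_
  ext t
  rw [charFun_map_add_prod_eq_mul, charFun_map_smul]
  simp only [Pi.mul_apply, charFun_map_smul, charFun_stdGaussian, ← Complex.exp_add, norm_smul,
    Real.norm_of_nonneg (Real.sqrt_nonneg _)]
  congr 1
  norm_cast
  rw [mul_pow, mul_pow, mul_pow, Real.sq_sqrt (by positivity)]
  simp only [Real.norm_eq_abs, sq_abs]
  ring

/-- Rotations of `E × E` preserve the law of a pair of independent standard Gaussian vectors. -/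
theorem measurePreserving_rotation {a b : ℝ} (hab : a ^ 2 + b ^ 2 = 1) :
    MeasurePreserving (fun p : E × E => (a • p.1 + b • p.2, b • p.1 - a • p.2))
      ((stdGaussian E).prod (stdGaussian E)) ((stdGaussian E).prod (stdGaussian E)) := by
  refine ⟨by fun_prop, ?_⟩
  have : IsProbabilityMeasure (((stdGaussian E).prod (stdGaussian E)).map
    (fun p : E × E => (a • p.1 + b • p.2, b • p.1 - a • p.2))) :=
    Measure.isProbabilityMeasure_map (by fun_prop)
  refine charFun_eq_prod_iff.1 fun t => ?_
  rw [charFun_apply, Measure.map_map (WithLp.measurable_toLp 2 (E × E)) (by fun_prop),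
    integral_map (by fun_prop) (Measurable.aestronglyMeasurable (by fun_prop))]
  -- The matrix with rows `(a, b)` and `(b, -a)` is symmetric, so pairing with `t` moves the same
  -- map onto `t`; it is also orthogonal, so the norm of `t` is unchanged.
  have key := charFun_prod (μ := stdGaussian E) (ν := stdGaussian E)
    (WithLp.toLp 2 (a • t.fst + b • t.snd, b • t.fst - a • t.snd))
  rw [charFun_apply, integral_map (by fun_prop)
    (Measurable.aestronglyMeasurable (by fun_prop))] at key
  convert key using 1
  · refine integral_congr_ae (Filter.Eventually.of_forall fun p => ?_)
    simp only [Function.comp_apply, WithLp.prod_inner_apply, inner_add_left, inner_add_right,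
      inner_sub_left, inner_sub_right, real_inner_smul_left, real_inner_smul_right]
    congr 3
    simp only [WithLp.ofLp_fst, WithLp.ofLp_snd]
    ring
  · simp only [charFun_stdGaussian, ← Complex.exp_add]
    congr 1
    norm_cast
    simp only [WithLp.ofLp_fst, WithLp.ofLp_snd, ← real_inner_self_eq_norm_sq, inner_add_left,
      inner_add_right,
      inner_sub_left, inner_sub_right, real_inner_smul_left, real_inner_smul_right]
    rw [real_inner_comm t.snd t.fst]
    linear_combination (1 / 2 * (inner ℝ t.fst t.fst + inner ℝ t.snd t.snd)) * hab

end Gaussian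
end ProbabilityTheory

/-! ### The Ornstein–Uhlenbeck semigroup on Lipschitz functions. -/

namespace ProbabilityTheory

theorem integrable_mul_of_memLp_two {α : Type*} {mα : MeasurableSpace α} {μ : Measure α}
    {f g : α → ℝ} (hf : MemLp f 2 μ) (hg : MemLp g 2 μ) : Integrable (fun x => f x * g x) μ :=
  hf.integrable_mul hg

theorem sq_integral_mul_le {α : Type*} {mα : MeasurableSpace α} {μ : Measure α} {f g : α → ℝ}
    (hf : MemLp f 2 μ) (hg : MemLp g 2 μ) :
    (∫ x, f x * g x ∂μ) ^ 2 ≤ (∫ x, f x ^ 2 ∂μ) * ∫ x, g x ^ 2 ∂μ := by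
  have hfg : Integrable (fun x => f x * g x) μ := hf.integrable_mul hg
  -- The quadratic `t ↦ ∫ (f + t g)²` is nonnegative, so its discriminant is nonpositive.
  have h : ∀ t : ℝ, 0 ≤ (∫ x, g x ^ 2 ∂μ) * (t * t) + (2 * ∫ x, f x * g x ∂μ) * t
      + ∫ x, f x ^ 2 ∂μ := by
    intro t
    have h0 : 0 ≤ ∫ x, (f x + t * g x) ^ 2 ∂μ := integral_nonneg fun x => sq_nonneg _
    have h1 : ∫ x, (f x + t * g x) ^ 2 ∂μ = ∫ x, (f x ^ 2 + ((2 * t) * (f x * g x)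
        + t ^ 2 * g x ^ 2)) ∂μ := by
      congr with x
      ring
    have h2 : Integrable (fun x => (2 * t) * (f x * g x) + t ^ 2 * g x ^ 2) μ :=
      (hfg.const_mul _).add (hg.integrable_sq.const_mul _)
    rw [h1, integral_add hf.integrable_sq h2,
      integral_add (hfg.const_mul _) (hg.integrable_sq.const_mul _), integral_const_mul,
      integral_const_mul] at h0
    linarith
  have := discrim_le_zero h
  rw [discrim] at this
  linarith

theorem lipschitzWith_comp_affine {E : Type*} [NormedAddCommGroup E] [NormedSpace ℝ E]
    {f : E → ℝ} {K : NNReal} (hf : LipschitzWith K f) (x : E) (b : ℝ) :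
    LipschitzWith (K * ‖b‖₊) fun y => f (x + b • y) :=
  hf.comp (by
    refine LipschitzWith.of_dist_le_mul fun y z => ?_
    rw [dist_add_left, dist_eq_norm, ← smul_sub, norm_smul, dist_eq_norm]
    rfl)

section Poincare

variable {E : Type*} [NormedAddCommGroup E] [InnerProductSpace ℝ E] [FiniteDimensional ℝ E]
  [MeasurableSpace E] [BorelSpace E]

theorem memLp_norm_stdGaussian (p : ℝ≥0∞) (hp : p ≠ ∞) :
    MemLp (fun x : E => ‖x‖) p (stdGaussian E) :=
  (IsGaussian.memLp_id (stdGaussian E) p hp).norm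

theorem memLp_of_lipschitzWith {f : E → ℝ} {K : NNReal} (hf : LipschitzWith K f) (p : ℝ≥0∞)
    (hp : p ≠ ∞) : MemLp f p (stdGaussian E) := by
  have h : MemLp (fun x : E => |f 0| + K * ‖x‖) p (stdGaussian E) :=
    (memLp_const |f 0|).add ((memLp_norm_stdGaussian p hp).const_mul (K : ℝ))
  refine h.of_le hf.continuous.aestronglyMeasurable (Filter.Eventually.of_forall fun x => ?_)
  have h1 := hf.dist_le_mul x 0
  rw [Real.dist_eq, dist_zero_right] at h1
  rw [Real.norm_eq_abs, Real.norm_of_nonneg (by positivity)]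
  linarith [abs_sub_abs_le_abs_sub (f x) (f 0)]

/-- The Ornstein–Uhlenbeck semigroup, parametrized by the correlation `r`. -/
noncomputable def mehler (r : ℝ) (f : E → ℝ) (x : E) : ℝ :=
  ∫ y, f (r • x + √(1 - r ^ 2) • y) ∂(stdGaussian E)

theorem sq_add_sqrt_one_sub_sq {r : ℝ} (h0 : 0 ≤ r) (h1 : r ≤ 1) :
    r ^ 2 + √(1 - r ^ 2) ^ 2 = 1 := by
  rw [Real.sq_sqrt (by nlinarith)]
  ring

theorem memLp_comp_rotation {f : E → ℝ} {K : NNReal} (hf : LipschitzWith K f) {a b : ℝ}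
    (hab : a ^ 2 + b ^ 2 = 1) (p : ℝ≥0∞) (hp : p ≠ ∞) :
    MemLp (fun q : E × E => f (a • q.1 + b • q.2)) p ((stdGaussian E).prod (stdGaussian E)) :=
  ((memLp_of_lipschitzWith hf p hp).comp_fst (stdGaussian E)).comp_measurePreserving
    (measurePreserving_rotation hab)

theorem integrable_comp_affine {f : E → ℝ} {K : NNReal} (hf : LipschitzWith K f) (x : E)
    (b : ℝ) : Integrable (fun y => f (x + b • y)) (stdGaussian E) :=
  memLp_one_iff_integrable.1 (memLp_of_lipschitzWith (lipschitzWith_comp_affine hf x b) 1 (by simp))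

theorem lipschitzWith_mehler {f : E → ℝ} {K : NNReal} (hf : LipschitzWith K f) {r : ℝ}
    (h0 : 0 ≤ r) (h1 : r ≤ 1) : LipschitzWith K (mehler r f) := by
  refine LipschitzWith.of_dist_le_mul fun x x' => ?_
  rw [Real.dist_eq, mehler, mehler, ← integral_sub (integrable_comp_affine hf _ _)
    (integrable_comp_affine hf _ _)]
  have := norm_integral_le_of_norm_le_const (μ := stdGaussian E) (C := K * dist x x')
    (f := fun y => f (r • x + √(1 - r ^ 2) • y) - f (r • x' + √(1 - r ^ 2) • y))
    (Filter.Eventually.of_forall fun y => ?_)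
  · simpa using this
  · rw [Real.norm_eq_abs, ← Real.dist_eq]
    refine (hf.dist_le_mul _ _).trans ?_
    rw [dist_add_right, dist_smul₀, Real.norm_of_nonneg h0]
    have := dist_nonneg (x := x) (y := x')
    gcongr
    nlinarith

theorem mehler_mehler {f : E → ℝ} {K : NNReal} (hf : LipschitzWith K f) {r s : ℝ}
    (hr0 : 0 ≤ r) (hr1 : r ≤ 1) (hs0 : 0 ≤ s) (hs1 : s ≤ 1) :
    mehler r (mehler s f) = mehler (r * s) f := by
  funext x
  have hr2 : r ^ 2 ≤ 1 := by nlinarith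
  have hs2 : s ^ 2 ≤ 1 := by nlinarith
  have hmap := map_smul_add_smul_stdGaussian (E := E) (s * √(1 - r ^ 2)) (√(1 - s ^ 2))
  have hsq : (s * √(1 - r ^ 2)) ^ 2 + √(1 - s ^ 2) ^ 2 = 1 - (r * s) ^ 2 := by
    rw [mul_pow, Real.sq_sqrt (by linarith), Real.sq_sqrt (by linarith)]
    ring
  rw [hsq] at hmap
  have hcont : Continuous fun y => f ((r * s) • x + y) := hf.continuous.comp (by fun_prop)
  have h1 : mehler (r * s) f x = ∫ z, f ((r * s) • x + z)
      ∂((stdGaussian E).map fun y => √(1 - (r * s) ^ 2) • y) := by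
    rw [integral_map (by fun_prop) hcont.aestronglyMeasurable, mehler]
  have hint : Integrable (fun z => f ((r * s) • x + z))
      ((stdGaussian E).map fun y => √(1 - (r * s) ^ 2) • y) := by
    rw [integrable_map_measure hcont.aestronglyMeasurable (by fun_prop)]
    exact integrable_comp_affine hf _ _
  rw [← hmap] at h1 hint
  rw [integrable_map_measure hcont.aestronglyMeasurable (by fun_prop)] at hint
  have hint' : Integrable (fun p : E × E => f ((r * s) • x +
    ((s * √(1 - r ^ 2)) • p.1 + √(1 - s ^ 2) • p.2))) ((stdGaussian E).prod (stdGaussian E)) := hint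
  rw [h1, integral_map (by fun_prop) hcont.aestronglyMeasurable, integral_prod _ hint', mehler]
  refine integral_congr_ae (Filter.Eventually.of_forall fun y => ?_)
  simp only [mehler]
  congr with z
  congr 1
  module

theorem integral_mul_mehler {f g : E → ℝ} {K K' : NNReal} (hf : LipschitzWith K f)
    (hg : LipschitzWith K' g) {r : ℝ} (h0 : 0 ≤ r) (h1 : r ≤ 1) :
    ∫ x, f x * mehler r g x ∂(stdGaussian E) =
      ∫ p : E × E, f p.1 * g (r • p.1 + √(1 - r ^ 2) • p.2)
        ∂((stdGaussian E).prod (stdGaussian E)) := by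
  have hint : Integrable (fun p : E × E => f p.1 * g (r • p.1 + √(1 - r ^ 2) • p.2))
      ((stdGaussian E).prod (stdGaussian E)) :=
    ((memLp_of_lipschitzWith hf 2 (by simp)).comp_fst _).integrable_mul
      (memLp_comp_rotation hg (sq_add_sqrt_one_sub_sq h0 h1) 2 (by simp))
  rw [integral_prod _ hint]
  refine integral_congr_ae (Filter.Eventually.of_forall fun y => ?_)
  simp only [mehler, integral_const_mul]

/-- The measure-preserving map of `measurePreserving_rotation` is an involution, so it exchanges
`p.1` with `r • p.1 + √(1 - r ^ 2) • p.2`. -/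
theorem integral_mul_mehler_comm {f g : E → ℝ} {K K' : NNReal} (hf : LipschitzWith K f)
    (hg : LipschitzWith K' g) {r : ℝ} (h0 : 0 ≤ r) (h1 : r ≤ 1) :
    ∫ x, f x * mehler r g x ∂(stdGaussian E) = ∫ x, mehler r f x * g x ∂(stdGaussian E) := by
  have hab := sq_add_sqrt_one_sub_sq h0 h1
  simp_rw [mul_comm (mehler r f _)]
  rw [integral_mul_mehler hf hg h0 h1, integral_mul_mehler hg hf h0 h1]
  have hmp := measurePreserving_rotation (E := E) hab
  conv_lhs => rw [← hmp.map_eq]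
  have hc : Continuous fun p : E × E => f p.1 * g (r • p.1 + √(1 - r ^ 2) • p.2) :=
    (hf.continuous.comp continuous_fst).mul (hg.continuous.comp (by fun_prop))
  rw [integral_map hmp.measurable.aemeasurable hc.aestronglyMeasurable]
  refine integral_congr_ae (Filter.Eventually.of_forall fun p => ?_)
  simp only
  rw [mul_comm]
  congr 2
  have h : r • (r • p.1 + √(1 - r ^ 2) • p.2) + √(1 - r ^ 2) • (√(1 - r ^ 2) • p.1 - r • p.2) =
    (r ^ 2 + √(1 - r ^ 2) ^ 2) • p.1 := by module
  rw [h, hab, one_smul]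

/-- Log-convexity of the correlation `c(r) = ∫ f · mehler r f`: by symmetry and the semigroup law
`c(r²) = ∫ (mehler r f)²`, and Cauchy–Schwarz applies. -/
theorem sq_integral_mul_mehler_le {f : E → ℝ} {K : NNReal} (hf : LipschitzWith K f) {r : ℝ}
    (h0 : 0 ≤ r) (h1 : r ≤ 1) :
    (∫ x, f x * mehler r f x ∂(stdGaussian E)) ^ 2 ≤
      (∫ x, f x ^ 2 ∂(stdGaussian E)) * ∫ x, f x * mehler (r ^ 2) f x ∂(stdGaussian E) := by
  have hm := lipschitzWith_mehler hf h0 h1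
  have h : ∫ x, f x * mehler (r ^ 2) f x ∂(stdGaussian E) =
      ∫ x, mehler r f x ^ 2 ∂(stdGaussian E) := by
    rw [sq, ← mehler_mehler hf h0 h1 h0 h1, integral_mul_mehler_comm hf hm h0 h1]
    simp_rw [sq]
  rw [h]
  exact sq_integral_mul_le (memLp_of_lipschitzWith hf 2 (by simp))
    (memLp_of_lipschitzWith hm 2 (by simp))

/-- The two points have the same law, so expanding the square leaves two equal second moments and a
correlation. -/
theorem integral_sq_sub_comp_rotation {f : E → ℝ} {K : NNReal} (hf : LipschitzWith K f) {r : ℝ}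
    (h0 : 0 ≤ r) (h1 : r ≤ 1) :
    ∫ p : E × E, (f (r • p.1 + √(1 - r ^ 2) • p.2) - f p.1) ^ 2
        ∂((stdGaussian E).prod (stdGaussian E)) =
      2 * (∫ x, f x ^ 2 ∂(stdGaussian E) - ∫ x, f x * mehler r f x ∂(stdGaussian E)) := by
  have hab := sq_add_sqrt_one_sub_sq h0 h1
  have hmp := measurePreserving_rotation (E := E) hab
  have hA : MemLp (fun p : E × E => f p.1) 2 ((stdGaussian E).prod (stdGaussian E)) :=
    (memLp_of_lipschitzWith hf 2 (by simp)).comp_fst _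
  have hB := memLp_comp_rotation hf hab 2 (by simp)
  have e1 : ∫ p : E × E, f p.1 ^ 2 ∂((stdGaussian E).prod (stdGaussian E)) =
      ∫ x, f x ^ 2 ∂(stdGaussian E) := by
    rw [integral_fun_fst (fun x => f x ^ 2)]
    simp
  have e2 : ∫ p : E × E, f (r • p.1 + √(1 - r ^ 2) • p.2) ^ 2
      ∂((stdGaussian E).prod (stdGaussian E)) = ∫ x, f x ^ 2 ∂(stdGaussian E) := by
    rw [← e1]
    conv_rhs => rw [← hmp.map_eq]
    have hc : Continuous fun p : E × E => f p.1 ^ 2 := (hf.continuous.comp continuous_fst).pow 2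
    rw [integral_map hmp.measurable.aemeasurable hc.aestronglyMeasurable]
  rw [integral_mul_mehler hf hf h0 h1]
  have : ∀ p : E × E, (f (r • p.1 + √(1 - r ^ 2) • p.2) - f p.1) ^ 2 =
      (f (r • p.1 + √(1 - r ^ 2) • p.2) ^ 2 + f p.1 ^ 2) -
        2 * (f p.1 * f (r • p.1 + √(1 - r ^ 2) • p.2)) := fun p => by ring
  simp_rw [this]
  have hS : Integrable (fun p : E × E => f (r • p.1 + √(1 - r ^ 2) • p.2) ^ 2 + f p.1 ^ 2)
    ((stdGaussian E).prod (stdGaussian E)) := hB.integrable_sq.add hA.integrable_sq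
  rw [integral_sub hS ((integrable_mul_of_memLp_two hA hB).const_mul 2),
    integral_add hB.integrable_sq hA.integrable_sq, e1, e2, integral_const_mul]
  ring

theorem integral_sq_strongDual_stdGaussian (L : StrongDual ℝ E) :
    ∫ y, L y ^ 2 ∂(stdGaussian E) = ‖L‖ ^ 2 := by
  rw [← variance_dual_stdGaussian L, variance_eq_integral L.continuous.aemeasurable]
  simp

/-- For centred `f` the correlation vanishes at `r = 0`. Comparing with that case, the argument of
`f` moves by `O(r)` because `1 - √(1 - r²) ≤ r`. -/
theorem integral_mul_mehler_le_mul {f : E → ℝ} {K : NNReal} (hf : LipschitzWith K f)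
    (hf0 : ∫ x, f x ∂(stdGaussian E) = 0) :
    ∃ C : ℝ, ∀ r, 0 ≤ r → r ≤ 1 → ∫ x, f x * mehler r f x ∂(stdGaussian E) ≤ C * r := by
  set ν := (stdGaussian E).prod (stdGaussian E)
  have hA : MemLp (fun p : E × E => f p.1) 2 ν :=
    (memLp_of_lipschitzWith hf 2 (by simp)).comp_fst _
  have hA' : MemLp (fun p : E × E => f p.2) 2 ν :=
    (memLp_of_lipschitzWith hf 2 (by simp)).comp_snd _
  have hN : MemLp (fun p : E × E => ‖p.1‖ + ‖p.2‖) 2 ν :=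
    ((memLp_norm_stdGaussian 2 (by simp)).comp_fst _).add
      ((memLp_norm_stdGaussian 2 (by simp)).comp_snd _)
  have hI : Integrable (fun p : E × E => |f p.1| * (‖p.1‖ + ‖p.2‖)) ν :=
    hA.norm.integrable_mul hN
  refine ⟨K * ∫ p : E × E, |f p.1| * (‖p.1‖ + ‖p.2‖) ∂ν, fun r h0 h1 => ?_⟩
  have hB := memLp_comp_rotation hf (sq_add_sqrt_one_sub_sq h0 h1) 2 (by simp)
  have hz : ∫ p : E × E, f p.1 * f p.2 ∂ν = 0 := by
    rw [integral_prod_mul (μ := stdGaussian E) (ν := stdGaussian E) f f, hf0, zero_mul]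
  rw [integral_mul_mehler hf hf h0 h1, ← sub_zero (∫ p : E × E, _ ∂_), ← hz,
    ← integral_sub (integrable_mul_of_memLp_two hA hB) (integrable_mul_of_memLp_two hA hA')]
  rw [mul_right_comm, ← integral_const_mul]
  refine integral_mono ((hA.integrable_mul hB).sub (hA.integrable_mul hA')) (hI.const_mul _)
    fun p => ?_
  simp only
  set s := √(1 - r ^ 2)
  have hs0 : 0 ≤ s := Real.sqrt_nonneg _
  have hs1 : s ≤ 1 := Real.sqrt_le_one.2 (by nlinarith)
  have hsr : 1 - s ≤ r := by
    have : 1 - r ≤ s := Real.le_sqrt_of_sq_le (by nlinarith)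
    linarith
  have hd := hf.dist_le_mul (r • p.1 + s • p.2) p.2
  rw [Real.dist_eq, dist_eq_norm] at hd
  have hn : ‖r • p.1 + s • p.2 - p.2‖ ≤ r * (‖p.1‖ + ‖p.2‖) := by
    have : r • p.1 + s • p.2 - p.2 = r • p.1 - (1 - s) • p.2 := by module
    rw [this]
    refine (norm_sub_le _ _).trans ?_
    rw [norm_smul, norm_smul, Real.norm_of_nonneg h0, Real.norm_of_nonneg (by linarith)]
    have := norm_nonneg p.2
    nlinarith
  calc f p.1 * f (r • p.1 + s • p.2) - f p.1 * f p.2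
      = f p.1 * (f (r • p.1 + s • p.2) - f p.2) := by ring
    _ ≤ |f p.1| * |f (r • p.1 + s • p.2) - f p.2| := by
        rw [← abs_mul]
        exact le_abs_self _
    _ ≤ |f p.1| * (K * (r * (‖p.1‖ + ‖p.2‖))) := by
        gcongr
        exact hd.trans (by gcongr)
    _ = _ := by ring

end Poincare
end ProbabilityTheory

/-! ### The Gaussian Poincaré inequality. -/

namespace ProbabilityTheory

section Poincare

variable {E : Type*} [NormedAddCommGroup E] [InnerProductSpace ℝ E] [FiniteDimensional ℝ E]
  [MeasurableSpace E] [BorelSpace E]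

open Filter Topology

theorem ae_prod_of_ae_fst {α β : Type*} {mα : MeasurableSpace α} {mβ : MeasurableSpace β}
    {μ : Measure α} {ν : Measure β} [SFinite ν] {p : α → Prop} (h : ∀ᵐ x ∂μ, p x) :
    ∀ᵐ z ∂(μ.prod ν), p z.1 :=
  Measure.quasiMeasurePreserving_fst.ae h

theorem integrable_sq_fderiv_apply {f : E → ℝ} {K : NNReal} (hf : LipschitzWith K f) :
    Integrable (fun p : E × E => (fderiv ℝ f p.1 p.2) ^ 2)
      ((stdGaussian E).prod (stdGaussian E)) := by
  have hm : Measurable fun p : E × E => fderiv ℝ f p.1 p.2 :=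
    ContinuousLinearMap.measurable_apply₂.comp
      (((measurable_fderiv ℝ f).comp measurable_fst).prodMk measurable_snd)
  have hN : MemLp (fun p : E × E => (K : ℝ) * ‖p.2‖) 2 ((stdGaussian E).prod (stdGaussian E)) :=
    ((memLp_norm_stdGaussian 2 (by simp)).comp_snd _).const_mul _
  refine (hN.of_le hm.aestronglyMeasurable (Eventually.of_forall fun p => ?_)).integrable_sq
  rw [Real.norm_of_nonneg (by positivity : 0 ≤ (K : ℝ) * ‖p.2‖)]
  exact ((fderiv ℝ f p.1).le_opNorm _).trans
    (by gcongr; exact norm_fderiv_le_of_lipschitz ℝ hf)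

/-- With `s = √(1 - r²)` the displacement is `s • p.2` up to order `s²`, so the quotient tends to
`(Df(p.1) p.2)²` wherever `f` is differentiable, which is almost everywhere by Rademacher. The
Lipschitz bound gives domination, and averaging over `p.2` yields `‖Df‖²`. -/
theorem tendsto_integral_sq_sub_comp_rotation {f : E → ℝ} {K : NNReal} (hf : LipschitzWith K f) :
    Tendsto (fun r : ℝ => (1 - r ^ 2)⁻¹ *
      ∫ p : E × E, (f (r • p.1 + √(1 - r ^ 2) • p.2) - f p.1) ^ 2
        ∂((stdGaussian E).prod (stdGaussian E))) (𝓝[<] 1)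
      (𝓝 (∫ x, ‖fderiv ℝ f x‖ ^ 2 ∂(stdGaussian E))) := by
  have hlim : ∫ x, ‖fderiv ℝ f x‖ ^ 2 ∂(stdGaussian E) =
      ∫ p : E × E, (fderiv ℝ f p.1 p.2) ^ 2 ∂((stdGaussian E).prod (stdGaussian E)) := by
    rw [integral_prod _ (integrable_sq_fderiv_apply hf)]
    simp_rw [integral_sq_strongDual_stdGaussian]
  rw [hlim]
  simp_rw [← integral_const_mul]
  have hev : ∀ᶠ r : ℝ in 𝓝[<] 1, r ∈ Set.Ioo 0 1 := Ioo_mem_nhdsLT one_pos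
  have hN : MemLp (fun p : E × E => ‖p.1‖ + ‖p.2‖) 2 ((stdGaussian E).prod (stdGaussian E)) :=
    ((memLp_norm_stdGaussian 2 (by simp)).comp_fst _).add
      ((memLp_norm_stdGaussian 2 (by simp)).comp_snd _)
  have hbase : ∀ r ∈ Set.Ioo (0 : ℝ) 1, 0 < √(1 - r ^ 2) ∧ √(1 - r ^ 2) ^ 2 = 1 - r ^ 2 ∧
      1 - r ≤ √(1 - r ^ 2) ^ 2 ∧ √(1 - r ^ 2) ≤ 1 := by
    rintro r ⟨h0, h1⟩
    have h : 0 < 1 - r ^ 2 := by nlinarith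
    refine ⟨Real.sqrt_pos.2 h, Real.sq_sqrt h.le, ?_, Real.sqrt_le_one.2 (by nlinarith)⟩
    rw [Real.sq_sqrt h.le]
    nlinarith
  refine tendsto_integral_filter_of_dominated_convergence
    (fun p => (K : ℝ) ^ 2 * (‖p.1‖ + ‖p.2‖) ^ 2) ?_ ?_ (hN.integrable_sq.const_mul _) ?_
  · refine Eventually.of_forall fun r => Continuous.aestronglyMeasurable ?_
    exact continuous_const.mul (((hf.continuous.comp (by fun_prop)).sub
      (hf.continuous.comp (by fun_prop))).pow 2)
  · filter_upwards [hev] with r hr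
    refine Eventually.of_forall fun p => ?_
    obtain ⟨hs, hs2, hs3, hs4⟩ := hbase r hr
    set s := √(1 - r ^ 2)
    have hd := hf.dist_le_mul (r • p.1 + s • p.2) p.1
    rw [Real.dist_eq, dist_eq_norm] at hd
    have hn : ‖r • p.1 + s • p.2 - p.1‖ ≤ s * (‖p.1‖ + ‖p.2‖) := by
      have : r • p.1 + s • p.2 - p.1 = s • p.2 - (1 - r) • p.1 := by module
      rw [this]
      refine (norm_sub_le _ _).trans ?_
      rw [norm_smul, norm_smul, Real.norm_of_nonneg hs.le, Real.norm_of_nonneg (by linarith [hr.2])]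
      have h : 1 - r ≤ s := hs3.trans (by nlinarith)
      have := mul_le_mul_of_nonneg_right h (norm_nonneg p.1)
      linarith
    rw [← hs2, norm_mul, norm_inv, norm_pow, norm_pow, Real.norm_of_nonneg hs.le, Real.norm_eq_abs,
      inv_mul_le_iff₀ (by positivity)]
    calc |f (r • p.1 + s • p.2) - f p.1| ^ 2 ≤ (K * (s * (‖p.1‖ + ‖p.2‖))) ^ 2 := by
          gcongr
          exact hd.trans (by gcongr)
      _ = _ := by ring
  · have hae : ∀ᵐ x ∂(stdGaussian E), DifferentiableAt ℝ f x :=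
      stdGaussian_absolutelyContinuous.ae_le hf.ae_differentiableAt
    filter_upwards [ae_prod_of_ae_fst (ν := stdGaussian E) hae] with p hp
    have hs0 : Tendsto (fun r : ℝ => √(1 - r ^ 2)) (𝓝[<] 1) (𝓝 0) := by
      have : ContinuousAt (fun r : ℝ => √(1 - r ^ 2)) 1 := by fun_prop
      have h := this.tendsto.mono_left (nhdsWithin_le_nhds (s := Set.Iio 1))
      simpa using h
    have hd0 : Tendsto (fun r : ℝ => (r - 1) • p.1 + √(1 - r ^ 2) • p.2) (𝓝[<] 1) (𝓝 0) := by
      have hr1 : Tendsto (fun r : ℝ => r - 1) (𝓝[<] 1) (𝓝 0) := by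
        have : ContinuousAt (fun r : ℝ => r - 1) 1 := by fun_prop
        simpa using this.tendsto.mono_left (nhdsWithin_le_nhds (s := Set.Iio 1))
      simpa using (hr1.smul_const p.1).add (hs0.smul_const p.2)
    have hquot : Tendsto (fun r : ℝ => (√(1 - r ^ 2))⁻¹ * (r - 1)) (𝓝[<] 1) (𝓝 0) := by
      refine squeeze_zero_norm' ?_ hs0
      filter_upwards [hev] with r hr
      obtain ⟨hs, hs2, hs3, hs4⟩ := hbase r hr
      rw [norm_mul, norm_inv, Real.norm_of_nonneg hs.le, Real.norm_eq_abs, abs_sub_comm,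
        abs_of_nonneg (by linarith [hr.2]), inv_mul_le_iff₀ hs, ← sq]
      exact hs3
    have hcd : Tendsto (fun r : ℝ => (√(1 - r ^ 2))⁻¹ • ((r - 1) • p.1 + √(1 - r ^ 2) • p.2))
        (𝓝[<] 1) (𝓝 p.2) := by
      have h : Tendsto (fun r : ℝ => ((√(1 - r ^ 2))⁻¹ * (r - 1)) • p.1 + p.2) (𝓝[<] 1)
          (𝓝 ((0 : ℝ) • p.1 + p.2)) := (hquot.smul_const _).add_const _
      rw [zero_smul, zero_add] at h
      refine h.congr' ?_
      filter_upwards [hev] with r hr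
      rw [smul_add, smul_smul, smul_smul, inv_mul_cancel₀ (hbase r hr).1.ne', one_smul]
    have hl := (hp.hasFDerivAt.hasFDerivWithinAt (s := Set.univ)).lim
      hd0 (Eventually.of_forall fun _ => Set.mem_univ _) hcd
    refine (hl.pow 2).congr' ?_
    filter_upwards [hev] with r hr
    rw [smul_eq_mul, mul_pow, inv_pow, (hbase r hr).2.1]
    congr 4
    module

/-- If `V > D`, the slope of the correlation `c` at `1` forces `c r ≥ V r ^ q` near `1` for some `q
< 1`. Log-convexity carries this bound from `r` to `r²`, hence to all of `(0, 1)`, which contradicts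
`c r ≤ C r` as `r → 0`. -/
theorem integral_sq_le_of_integral_eq_zero {f : E → ℝ} {K : NNReal} (hf : LipschitzWith K f)
    (hf0 : ∫ x, f x ∂(stdGaussian E) = 0) :
    ∫ x, f x ^ 2 ∂(stdGaussian E) ≤ ∫ x, ‖fderiv ℝ f x‖ ^ 2 ∂(stdGaussian E) := by
  by_contra! hlt
  set V := ∫ x, f x ^ 2 ∂(stdGaussian E)
  set D := ∫ x, ‖fderiv ℝ f x‖ ^ 2 ∂(stdGaussian E)
  set c : ℝ → ℝ := fun r => ∫ x, f x * mehler r f x ∂(stdGaussian E)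
  have hD : 0 ≤ D := integral_nonneg fun _ => by positivity
  have hV : 0 < V := hD.trans_lt hlt
  obtain ⟨q, hq0, hq1, hDq⟩ : ∃ q : ℝ, 0 ≤ q ∧ q < 1 ∧ D < q * V := by
    refine ⟨(D / V + 1) / 2, by positivity, ?_, ?_⟩
    · have : D / V < 1 := (div_lt_one hV).2 hlt
      linarith
    · have : (D / V + 1) / 2 * V = (D + V) / 2 := by field_simp
      rw [this]
      linarith
  have hnear : ∀ᶠ r : ℝ in 𝓝[<] 1, V * r ^ q ≤ c r := by
    filter_upwards [(tendsto_integral_sq_sub_comp_rotation hf).eventually_lt_const hDq,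
      Ioo_mem_nhdsLT one_pos] with r hr hr01
    have h : 0 < 1 - r ^ 2 := by nlinarith [hr01.1, hr01.2]
    rw [integral_sq_sub_comp_rotation hf hr01.1.le hr01.2.le, inv_mul_lt_iff₀ h] at hr
    have hr' : 2 * (V - c r) < (1 - r ^ 2) * (q * V) := hr
    -- Bernoulli's inequality for exponents in `[0, 1]`: the concave power lies below its tangent at
    -- `1`.
    have hb : r ^ q ≤ 1 + q * (r - 1) := by
      have := rpow_one_add_le_one_add_mul_self (s := r - 1) (p := q)
        (by linarith [hr01.1]) hq0 hq1.le
      simpa using this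
    have h2 : (1 - r ^ 2) * (q * V) ≤ 2 * (1 - r) * (q * V) := by
      gcongr
      nlinarith [hr01.1, hr01.2]
    nlinarith
  have hdouble : ∀ r ∈ Set.Ioo (0 : ℝ) 1, V * r ^ q ≤ c r → V * (r ^ 2) ^ q ≤ c (r ^ 2) := by
    rintro r ⟨h0, h1⟩ h
    have hcs : c r ^ 2 ≤ V * c (r ^ 2) := sq_integral_mul_mehler_le hf h0.le h1.le
    have hrq : 0 ≤ r ^ q := Real.rpow_nonneg h0.le _
    have e : (r ^ 2) ^ q = (r ^ q) ^ 2 := by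
      rw [← Real.rpow_natCast, ← Real.rpow_mul h0.le, mul_comm, Real.rpow_mul h0.le,
        Real.rpow_natCast]
    have h3 : (V * r ^ q) ^ 2 ≤ V * c (r ^ 2) := (pow_le_pow_left₀ (by positivity) h 2).trans hcs
    rw [e]
    refine le_of_mul_le_mul_left ?_ hV
    linarith
  have hall : ∀ r ∈ Set.Ioo (0 : ℝ) 1, V * r ^ q ≤ c r := by
    rintro r ⟨h0, h1⟩
    have hdown : ∀ n : ℕ, ∀ t ∈ Set.Ioo (0 : ℝ) 1, V * t ^ q ≤ c t →
        V * (t ^ 2 ^ n) ^ q ≤ c (t ^ 2 ^ n) := by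
      intro n
      induction n with
      | zero => intro t _ h; simpa using h
      | succ n ih =>
        intro t ht h
        have := hdouble (t ^ 2 ^ n) ⟨pow_pos ht.1 _, pow_lt_one₀ ht.1.le ht.2 (by simp)⟩ (ih t ht h)
        rwa [← pow_mul, ← pow_succ] at this
    -- Iterated square roots of `r` tend to `1`, so one of them lies where `hnear` holds; squaring
    -- back returns to `r`.
    have htend : Tendsto (fun n : ℕ => r ^ ((2 : ℝ) ^ n)⁻¹) atTop (𝓝[<] 1) := by
      refine tendsto_nhdsWithin_iff.2 ⟨?_, Eventually.of_forall fun n =>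
        Real.rpow_lt_one h0.le h1 (by positivity)⟩
      have h : Tendsto (fun n : ℕ => ((2 : ℝ) ^ n)⁻¹) atTop (𝓝 0) :=
        tendsto_inv_atTop_zero.comp (tendsto_pow_atTop_atTop_of_one_lt one_lt_two)
      simpa [Function.comp_def] using
        (Real.continuousAt_const_rpow (a := r) (b := 0) h0.ne').tendsto.comp h
    obtain ⟨n, hn⟩ := (htend.eventually hnear).exists
    have := hdown n _ ⟨Real.rpow_pos_of_pos h0 _, Real.rpow_lt_one h0.le h1 (by positivity)⟩ hn
    have e : (r ^ ((2 : ℝ) ^ n)⁻¹) ^ 2 ^ n = r := by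
      rw [← Real.rpow_natCast, ← Real.rpow_mul h0.le]
      simp
    rwa [e] at this
  obtain ⟨C, hC⟩ := integral_mul_mehler_le_mul hf hf0
  have hle : ∀ r ∈ Set.Ioo (0 : ℝ) 1, V ≤ C * r ^ (1 - q) := by
    intro r hr
    have h := (hall r hr).trans (hC r hr.1.le hr.2.le)
    have hrq : 0 < r ^ q := Real.rpow_pos_of_pos hr.1 _
    rw [Real.rpow_sub hr.1, Real.rpow_one, ← mul_div_assoc, le_div_iff₀ hrq]
    exact h
  have hlim : Tendsto (fun r : ℝ => C * r ^ (1 - q)) (𝓝[>] 0) (𝓝 0) := by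
    have : ContinuousAt (fun r : ℝ => C * r ^ (1 - q)) 0 :=
      continuousAt_const.mul (Real.continuousAt_rpow_const _ _ (Or.inr (by linarith)))
    have h := this.tendsto.mono_left (nhdsWithin_le_nhds (s := Set.Ioi 0))
    simpa [Real.zero_rpow (by linarith : 1 - q ≠ 0)] using h
  have : V ≤ 0 := ge_of_tendsto hlim (by
    filter_upwards [Ioo_mem_nhdsGT one_pos] with r hr using hle r hr)
  linarith

/-- **Gaussian Poincaré inequality** for Lipschitz functions. -/
theorem variance_stdGaussian_le {f : E → ℝ} {K : NNReal} (hf : LipschitzWith K f) :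
    Var[f; stdGaussian E] ≤ ∫ x, ‖fderiv ℝ f x‖ ^ 2 ∂(stdGaussian E) := by
  set a := ∫ x, f x ∂(stdGaussian E) with ha
  have hfa : LipschitzWith K fun x => f x - a := by
    refine LipschitzWith.of_dist_le_mul fun x y => ?_
    rw [dist_sub_right]
    exact hf.dist_le_mul x y
  have hint : Integrable f (stdGaussian E) :=
    memLp_one_iff_integrable.1 (memLp_of_lipschitzWith hf 1 (by simp))
  have h := integral_sq_le_of_integral_eq_zero hfa (by
    rw [integral_sub hint (integrable_const _)]
    simp [ha])
  simp only [fderiv_sub_const] at h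
  rwa [variance_eq_integral hf.continuous.aemeasurable]

end Poincare
end ProbabilityTheory

/-! ### Derivative bounds and products of Gaussians. -/

namespace ProbabilityTheory

/-- The bound `g` may vary with `t`: the modulus `max (l x) (l y)` reduces to `l x` only in the
limit. -/
theorem abs_fderiv_apply_le {V : Type*} [NormedAddCommGroup V] [NormedSpace ℝ V] {f : V → ℝ}
    {x v : V} (hf : DifferentiableAt ℝ f x) {g : ℝ → ℝ} (hg : ContinuousAt g 0)
    (h : ∀ t, 0 < t → |f (x + t • v) - f x| ≤ t * g t) : |fderiv ℝ f x v| ≤ g 0 := by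
  have h1 := (hf.hasFDerivAt.lim_real v).abs
  have h2 := hg.tendsto.comp (tendsto_inv_atTop_zero (𝕜 := ℝ))
  refine le_of_tendsto_of_tendsto h1 h2 ?_
  filter_upwards [Filter.eventually_gt_atTop 0] with c hc
  have := h c⁻¹ (inv_pos.2 hc)
  rw [smul_eq_mul, abs_mul, abs_of_pos hc, Function.comp_apply]
  calc c * |f (x + c⁻¹ • v) - f x| ≤ c * (c⁻¹ * g c⁻¹) := by gcongr
    _ = g c⁻¹ := by rw [← mul_assoc, mul_inv_cancel₀ hc.ne', one_mul]

theorem sq_norm_le_sum_of_apply_single_le {E ι : Type*} [NormedAddCommGroup E]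
    [InnerProductSpace ℝ E] [Fintype ι] [DecidableEq ι] (T : StrongDual ℝ (PiLp 2 fun _ : ι => E))
    {G : ι → ℝ} (h : ∀ i u, |T (WithLp.toLp 2 (Pi.single i u))| ≤ G i * ‖u‖) :
    ‖T‖ ^ 2 ≤ ∑ i, G i ^ 2 := by
  have hS : 0 ≤ ∑ i, G i ^ 2 := Finset.sum_nonneg fun _ _ => sq_nonneg _
  suffices ‖T‖ ≤ √(∑ i, G i ^ 2) by
    calc ‖T‖ ^ 2 ≤ √(∑ i, G i ^ 2) ^ 2 := by gcongr
      _ = _ := Real.sq_sqrt hS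
  refine T.opNorm_le_bound (Real.sqrt_nonneg _) fun v => ?_
  have hv : v = ∑ i, WithLp.toLp 2 (Pi.single i (v i)) := by
    ext j
    simp [WithLp.ofLp_sum, Finset.sum_apply, Pi.single_apply]
  calc ‖T v‖ = |∑ i, T (WithLp.toLp 2 (Pi.single i (v i)))| := by
        conv_lhs => rw [hv]
        rw [map_sum, Real.norm_eq_abs]
    _ ≤ ∑ i, G i * ‖v i‖ := (Finset.abs_sum_le_sum_abs _ _).trans
        (Finset.sum_le_sum fun i _ => h i _)
    _ ≤ √(∑ i, G i ^ 2) * √(∑ i, ‖v i‖ ^ 2) := Real.sum_mul_le_sqrt_mul_sqrt _ _ _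
    _ = _ := by rw [PiLp.norm_eq_of_L2]

theorem map_toLp_pi_stdGaussian {E ι : Type*} [NormedAddCommGroup E] [InnerProductSpace ℝ E]
    [FiniteDimensional ℝ E] [MeasurableSpace E] [BorelSpace E] [Fintype ι] :
    (Measure.pi fun _ : ι => stdGaussian E).map (WithLp.toLp 2) =
      stdGaussian (PiLp 2 fun _ : ι => E) := by
  refine Measure.ext_of_charFun ?_
  ext t
  rw [charFun_pi]
  simp_rw [charFun_stdGaussian, ← Complex.exp_sum, ← Complex.ofReal_pow, PiLp.norm_sq_eq_of_L2]
  congr 1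
  push_cast
  rw [← Finset.sum_div, Finset.sum_neg_distrib]

end ProbabilityTheory

/-! ### Contraction of the gradient step. -/

namespace ULA

variable {d : ℕ} {U : EuclideanSpace ℝ (Fin d) → ℝ} {m L : ℝ}

theorem GradientLipschitz.le_add_inner_add_sq (hL : GradientLipschitz U L)
    (x y : EuclideanSpace ℝ (Fin d)) :
    U y ≤ U x + inner ℝ (∇ U x) (y - x) + L / 2 * ‖y - x‖ ^ 2 := by
  set v := y - x with hv
  have hd : ∀ t : ℝ, HasDerivAt (fun t : ℝ => U (x + t • v) - t * inner ℝ (∇ U x) v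
      - L / 2 * t ^ 2 * ‖v‖ ^ 2) (inner ℝ (∇ U (x + t • v)) v - inner ℝ (∇ U x) v
      - L * t * ‖v‖ ^ 2) t := by
    intro t
    have h1 : HasDerivAt (fun t : ℝ => x + t • v) v t := by
      simpa using ((hasDerivAt_id t).smul_const v).const_add x
    have h2 : HasFDerivAt U (InnerProductSpace.toDual ℝ _ (∇ U (x + t • v))) (x + t • v) :=
      (hL.contDiff.differentiable (by simp) _).hasGradientAt.hasFDerivAt
    have h3 := h2.comp_hasDerivAt t h1
    simp only [InnerProductSpace.toDual_apply_apply] at h3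
    have h4 := (h3.sub ((hasDerivAt_id t).mul_const (inner ℝ (∇ U x) v))).sub
      (((hasDerivAt_pow 2 t).const_mul (L / 2)).mul_const (‖v‖ ^ 2))
    refine h4.congr_deriv ?_
    push_cast
    ring
  have hle := Convex.image_sub_le_mul_sub_of_deriv_le (convex_Icc (0 : ℝ) 1)
    (f := fun t : ℝ => U (x + t • v) - t * inner ℝ (∇ U x) v - L / 2 * t ^ 2 * ‖v‖ ^ 2) (C := 0)
    (fun t _ => (hd t).continuousAt.continuousWithinAt)
    (fun t _ => (hd t).differentiableAt.differentiableWithinAt) (fun t ht => by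
      rw [(hd t).deriv]
      rw [interior_Icc] at ht
      have h1 : inner ℝ (∇ U (x + t • v) - ∇ U x) v ≤ L * t * ‖v‖ ^ 2 := by
        refine (real_inner_le_norm _ _).trans ?_
        have := hL.lipschitz (x + t • v) x
        rw [add_sub_cancel_left, norm_smul, Real.norm_of_nonneg ht.1.le] at this
        calc ‖∇ U (x + t • v) - ∇ U x‖ * ‖v‖ ≤ L * (t * ‖v‖) * ‖v‖ := by gcongr
          _ = _ := by ring
      rw [inner_sub_left] at h1
      linarith) 0 (by simp) 1 (by simp) zero_le_one
  simp only [one_smul, zero_smul, add_zero] at hle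
  have hxy : x + v = y := by simp [hv]
  rw [hxy] at hle
  linarith

/-- The quadratic lower and upper bounds on `U` are compared at a unit vector, which exists since `d
≥ 1`. -/
theorem le_of_gradientLipschitz_of_stronglyConvex (hd : 1 ≤ d) (hL : GradientLipschitz U L)
    (hU : StronglyConvex U m) : m ≤ L := by
  have : NeZero d := ⟨by omega⟩
  set v : EuclideanSpace ℝ (Fin d) := EuclideanSpace.single 0 1
  have hv : ‖v‖ = 1 := by simp [v]
  have h1 := hU.lower_bound 0 v
  have h2 := hL.le_add_inner_add_sq 0 v
  rw [norm_sub_rev] at h1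
  simp only [sub_zero, hv] at h1 h2
  linarith

/-- This is co-coercivity of the gradient of `U - (m/2)‖·‖²`, a convex function with upper quadratic
constant `L - m`. Its lower bound from `y` and upper bound from `x` are compared at `x - t • g`,
with `g` the difference of its gradients, then symmetrized in `x` and `y`. -/
theorem cocoercive (hmL : m ≤ L) (hL : GradientLipschitz U L) (hU : StronglyConvex U m)
    (x y : EuclideanSpace ℝ (Fin d)) :
    ‖∇ U x - ∇ U y‖ ^ 2 + m * L * ‖x - y‖ ^ 2 ≤
      (m + L) * inner ℝ (∇ U x - ∇ U y) (x - y) := by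
  have hone : ∀ (x y : EuclideanSpace ℝ (Fin d)) (t : ℝ),
      U y - U x + inner ℝ (∇ U y) (x - y) + m / 2 * ‖x - y‖ ^ 2
        + t * ‖∇ U x - ∇ U y - m • (x - y)‖ ^ 2 ≤
      (L - m) / 2 * t ^ 2 * ‖∇ U x - ∇ U y - m • (x - y)‖ ^ 2 := by
    intro x y t
    set g := ∇ U x - ∇ U y - m • (x - y) with hg
    have h1 := hU.lower_bound y (x - t • g)
    have h2 := hL.le_add_inner_add_sq x (x - t • g)
    have e1 : x - t • g - y = (x - y) - t • g := by abel
    have e2 : x - t • g - x = -(t • g) := by abel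
    have e3 : y - (x - t • g) = -((x - y) - t • g) := by abel
    have e4 : inner ℝ g g =
        inner ℝ (∇ U x) g - inner ℝ (∇ U y) g - m * inner ℝ (x - y) g := by
      conv_lhs => rw [hg, inner_sub_left, inner_sub_left, real_inner_smul_left]
    rw [real_inner_self_eq_norm_sq] at e4
    rw [e1, e3, norm_neg, norm_sub_sq_real, inner_sub_right, real_inner_smul_right,
      real_inner_smul_right, norm_smul, Real.norm_eq_abs, mul_pow, sq_abs] at h1
    rw [e2, norm_neg, inner_neg_right, real_inner_smul_right, norm_smul, Real.norm_eq_abs,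
      mul_pow, sq_abs] at h2
    linear_combination h1 + h2 + t * e4
  set h := x - y with hh
  set a := ∇ U x - ∇ U y with ha
  have hsum : ∀ t : ℝ, 2 * t * ‖a - m • h‖ ^ 2 ≤
      inner ℝ a h - m * ‖h‖ ^ 2 + (L - m) * t ^ 2 * ‖a - m • h‖ ^ 2 := by
    intro t
    have h1 := hone x y t
    have h2 := hone y x t
    have e : ∇ U y - ∇ U x - m • (y - x) = -(a - m • h) := by
      rw [ha, hh]
      module
    have e' : y - x = -h := by rw [hh, neg_sub]
    rw [e, norm_neg, e', norm_neg, inner_neg_right] at h2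
    rw [← hh, ← ha] at h1
    have e3 : inner ℝ a h = inner ℝ (∇ U x) h - inner ℝ (∇ U y) h := inner_sub_left _ _ _
    linear_combination h1 + h2 - e3
  have hco : ‖a - m • h‖ ^ 2 ≤ (L - m) * (inner ℝ a h - m * ‖h‖ ^ 2) := by
    rcases hmL.eq_or_lt with rfl | hlt
    -- For `m = L` the term in `t²` is absent, so a bound linear in `t` holds for every `t`; two
    -- values of `t` refute a positive slope.
    · by_contra! hpos
      rw [sub_self, zero_mul] at hpos
      have h1 := hsum 1
      have h2 := hsum ((inner ℝ a h - m * ‖h‖ ^ 2) / ‖a - m • h‖ ^ 2)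
      have e : 2 * ((inner ℝ a h - m * ‖h‖ ^ 2) / ‖a - m • h‖ ^ 2) * ‖a - m • h‖ ^ 2 =
          2 * (inner ℝ a h - m * ‖h‖ ^ 2) := by
        rw [mul_assoc, div_mul_cancel₀ _ hpos.ne']
      rw [e, sub_self] at h2
      linarith
    · have hp : 0 < L - m := sub_pos.2 hlt
      -- The optimal `t`.
      have h1 := hsum (L - m)⁻¹
      have h2 := mul_le_mul_of_nonneg_left h1 hp.le
      have e1 : (L - m) * (2 * (L - m)⁻¹ * ‖a - m • h‖ ^ 2) = 2 * ‖a - m • h‖ ^ 2 := by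
        field_simp
      have e2 : (L - m) * (inner ℝ a h - m * ‖h‖ ^ 2
          + (L - m) * (L - m)⁻¹ ^ 2 * ‖a - m • h‖ ^ 2) =
          (L - m) * (inner ℝ a h - m * ‖h‖ ^ 2) + ‖a - m • h‖ ^ 2 := by
        field_simp
      rw [e1, e2] at h2
      linarith
  rw [norm_sub_sq_real, real_inner_smul_right, norm_smul, Real.norm_eq_abs, mul_pow, sq_abs] at hco
  linear_combination hco

theorem sq_norm_gradientStep_sub_le (hm : 0 < m) (hmL : m ≤ L) (hL : GradientLipschitz U L)
    (hU : StronglyConvex U m) {g : ℝ} (hg0 : 0 ≤ g) (hg : g ≤ 2 / (m + L))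
    (x y : EuclideanSpace ℝ (Fin d)) :
    ‖(x - g • ∇ U x) - (y - g • ∇ U y)‖ ^ 2 ≤ (1 - kappa m L * g) * ‖x - y‖ ^ 2 := by
  have hc := cocoercive hmL hL hU x y
  have hs : 0 < m + L := by linarith
  have e : (x - g • ∇ U x) - (y - g • ∇ U y) = (x - y) - g • (∇ U x - ∇ U y) := by module
  rw [e, norm_sub_sq_real, real_inner_smul_right, norm_smul, Real.norm_eq_abs, mul_pow, sq_abs,
    real_inner_comm, kappa]
  have h1 : g * (2 / (m + L)) * (‖∇ U x - ∇ U y‖ ^ 2 + m * L * ‖x - y‖ ^ 2) ≤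
      2 * (g * inner ℝ (∇ U x - ∇ U y) (x - y)) := by
    calc _ ≤ g * (2 / (m + L)) * ((m + L) * inner ℝ (∇ U x - ∇ U y) (x - y)) := by gcongr
      _ = _ := by field_simp
  -- The step-size restriction lets the squared-gradient term of co-coercivity absorb this one.
  have h2 : g ^ 2 * ‖∇ U x - ∇ U y‖ ^ 2 ≤ g * (2 / (m + L)) * ‖∇ U x - ∇ U y‖ ^ 2 := by
    rw [sq g]
    gcongr
  have e2 : g * (2 / (m + L)) * (m * L * ‖x - y‖ ^ 2) =
    2 * m * L / (m + L) * g * ‖x - y‖ ^ 2 := by ring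
  linarith

theorem kappa_pos (hm : 0 < m) (hmL : m ≤ L) : 0 < kappa m L := by
  have : 0 < L := hm.trans_le hmL
  unfold kappa
  positivity

theorem kappa_mul_le_one (hm : 0 < m) (hmL : m ≤ L) {g : ℝ} (hg : g ≤ 2 / (m + L)) :
    kappa m L * g ≤ 1 := by
  have hs : 0 < m + L := by linarith
  calc kappa m L * g ≤ kappa m L * (2 / (m + L)) := by
        have := kappa_pos hm hmL
        gcongr
    _ = 4 * m * L / (m + L) ^ 2 := by
        rw [kappa]
        field_simp
        ring
    _ ≤ 1 := by
        rw [div_le_one (by positivity)]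
        nlinarith [sq_nonneg (m - L)]

end ULA

/-! ### Sensitivity of the path to the noise, and the law of the chain. -/

namespace ULA

variable {d : ℕ} {U : EuclideanSpace ℝ (Fin d) → ℝ} {m L : ℝ} {γ : ℕ → ℝ}

/-- The Langevin algorithm as a function of the noise sequence. -/
noncomputable def path (U : EuclideanSpace ℝ (Fin d) → ℝ) (γ : ℕ → ℝ)
    (x : EuclideanSpace ℝ (Fin d)) (k : ℕ) (z : ℕ → EuclideanSpace ℝ (Fin d)) :
    EuclideanSpace ℝ (Fin d) :=
  chain U γ x (fun i (z : ℕ → EuclideanSpace ℝ (Fin d)) => z i) k z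

theorem path_zero (x : EuclideanSpace ℝ (Fin d)) (z : ℕ → EuclideanSpace ℝ (Fin d)) :
    path U γ x 0 z = x := rfl

theorem path_succ (x : EuclideanSpace ℝ (Fin d)) (k : ℕ) (z : ℕ → EuclideanSpace ℝ (Fin d)) :
    path U γ x (k + 1) z = path U γ x k z - γ (k + 1) • ∇ U (path U γ x k z)
      + √(2 * γ (k + 1)) • z (k + 1) := rfl

theorem chain_eq_path {Ω : Type*} (x : EuclideanSpace ℝ (Fin d))
    (Z : ℕ → Ω → EuclideanSpace ℝ (Fin d)) (ω : Ω) (k : ℕ) {z : ℕ → EuclideanSpace ℝ (Fin d)}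
    (h : ∀ i, 1 ≤ i → i ≤ k → z i = Z i ω) : chain U γ x Z k ω = path U γ x k z := by
  induction k with
  | zero => rfl
  | succ k ih =>
    rw [path_succ, ← ih fun i h1 h2 => h i h1 (by omega), h (k + 1) (by omega) le_rfl]
    rfl

theorem measurable_path (x : EuclideanSpace ℝ (Fin d)) (k : ℕ) : Measurable (path U γ x k) := by
  induction k with
  | zero => exact measurable_const
  | succ k ih =>
    have h : Measurable fun z => ∇ U (path U γ x k z) := (measurable_gradient U).comp ih
    simp_rw [funext (path_succ (U := U) (γ := γ) x k)]
    fun_prop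

section Sensitivity

variable {c : ℕ → ℝ}
  (hc : ∀ k, 1 ≤ k → ∀ a b : EuclideanSpace ℝ (Fin d),
    ‖(a - γ k • ∇ U a) - (b - γ k • ∇ U b)‖ ≤ c k * ‖a - b‖)

include hc

theorem norm_path_succ_sub_le (x : EuclideanSpace ℝ (Fin d))
    (z w : ℕ → EuclideanSpace ℝ (Fin d)) (k : ℕ) :
    ‖path U γ x (k + 1) z - path U γ x (k + 1) w‖ ≤
      c (k + 1) * ‖path U γ x k z - path U γ x k w‖
        + √(2 * γ (k + 1)) * ‖z (k + 1) - w (k + 1)‖ := by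
  rw [path_succ, path_succ, add_sub_add_comm, ← smul_sub]
  refine (norm_add_le _ _).trans (add_le_add (hc (k + 1) (by omega) _ _) ?_)
  rw [norm_smul, Real.norm_of_nonneg (Real.sqrt_nonneg _)]

theorem norm_path_sub_le (hc1 : ∀ k, 1 ≤ k → c k ≤ 1)
    (x : EuclideanSpace ℝ (Fin d)) (z w : ℕ → EuclideanSpace ℝ (Fin d)) (k : ℕ) :
    ‖path U γ x k z - path U γ x k w‖ ≤
      ∑ i ∈ Finset.Icc 1 k, √(2 * γ i) * ‖z i - w i‖ := by
  induction k with
  | zero => simp [path_zero]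
  | succ k ih =>
    rw [Finset.sum_Icc_succ_top (by omega)]
    refine (norm_path_succ_sub_le hc x z w k).trans (add_le_add_left ?_ _)
    exact (mul_le_of_le_one_left (norm_nonneg _) (hc1 _ (by omega))).trans ih

/-- The paths coincide before time `j`, separate through the noise at time `j`, and see identical
noise afterwards, so each later step only contracts. -/
theorem norm_path_sub_le_of_eq_off (hc0 : ∀ k, 0 ≤ c k) (x : EuclideanSpace ℝ (Fin d))
    {z w : ℕ → EuclideanSpace ℝ (Fin d)} {j : ℕ} (hj : 1 ≤ j) (h : ∀ i, i ≠ j → z i = w i)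
    (k : ℕ) :
    ‖path U γ x k z - path U γ x k w‖ ≤
      (if j ≤ k then √(2 * γ j) * ∏ i ∈ Finset.Ioc j k, c i else 0) * ‖z j - w j‖ := by
  induction k with
  | zero => simp [path_zero, show ¬ j ≤ 0 by omega]
  | succ k ih =>
    refine (norm_path_succ_sub_le hc x z w k).trans ?_
    rcases lt_trichotomy j (k + 1) with hlt | rfl | hgt
    · rw [h (k + 1) (by omega), sub_self, norm_zero, mul_zero, add_zero, if_pos (by omega)]
      rw [if_pos (by omega)] at ih
      refine (mul_le_mul_of_nonneg_left ih (hc0 _)).trans (le_of_eq ?_)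
      rw [← Finset.insert_Ioc_right_eq_Ioc_add_one (by omega : j ≤ k), Finset.prod_insert (by simp)]
      ring
    · rw [if_neg (by omega), zero_mul] at ih
      rw [le_antisymm ih (norm_nonneg _)]
      simp
    · rw [if_neg (by omega), zero_mul] at ih
      rw [le_antisymm ih (norm_nonneg _), h (k + 1) (by omega)]
      simp [show ¬ j ≤ k + 1 by omega]

end Sensitivity

section Law

theorem withDensity_comp_sub {E : Type*} [NormedAddCommGroup E] [InnerProductSpace ℝ E]
    [FiniteDimensional ℝ E] [MeasurableSpace E] [BorelSpace E] (h : E → ℝ≥0∞) (a : E) :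
    (volume.withDensity fun y => h (y - a)) = (volume.withDensity h).map (· + a) := by
  ext s hs
  rw [withDensity_apply _ hs, Measure.map_apply (by fun_prop) hs,
    withDensity_apply _ (hs.preimage (by fun_prop)),
    ← (measurePreserving_add_right volume a).setLIntegral_comp_preimage_emb
      (measurableEmbedding_addRight a)]
  simp

theorem R_apply_eq_map {g : ℝ} (hg : 0 < g) (x : EuclideanSpace ℝ (Fin d)) :
    R U g x = (stdGaussian (EuclideanSpace ℝ (Fin d))).map
      fun z => x - g • ∇ U x + √(2 * g) • z := by
  -- With `b = (4g)⁻¹`, `(2b)^(-1/2) = √(2g)` is the noise scale and `π / b = 4πg` the normalization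
  -- in `stepDensity`.
  have h := withDensity_gaussian_eq_map_stdGaussian (E := EuclideanSpace ℝ (Fin d))
    (b := (4 * g)⁻¹) (by positivity)
  have h2 := withDensity_comp_sub (fun y : EuclideanSpace ℝ (Fin d) => ENNReal.ofReal
      ((Real.pi / (4 * g)⁻¹) ^ (-(Module.finrank ℝ (EuclideanSpace ℝ (Fin d)) : ℝ) / 2) *
        Real.exp (-(4 * g)⁻¹ * ‖y‖ ^ 2))) (x - g • ∇ U x)
  rw [h, Measure.map_map (by fun_prop) (by fun_prop)] at h2
  have e1 : (√(2 * (4 * g)⁻¹))⁻¹ = √(2 * g) := by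
    rw [← Real.sqrt_inv]
    congr 1
    field_simp
    norm_num
  have e2 : Real.pi / (4 * g)⁻¹ = 4 * Real.pi * g := by
    field_simp
  rw [e1, e2, finrank_euclideanSpace_fin] at h2
  change volume.withDensity (fun y => ENNReal.ofReal (stepDensity U g x y)) = _
  simp only [stepDensity]
  convert h2 using 2
  · funext y
    have e : y - x + g • ∇ U x = y - (x - g • ∇ U x) := by abel
    rw [e]
  · funext z
    exact add_comm _ _

theorem map_prod_eq_bind {α β δ : Type*} {mα : MeasurableSpace α} {mβ : MeasurableSpace β}
    {mδ : MeasurableSpace δ} (μ : Measure α) (ν : Measure β) [SFinite ν] {φ : α → β → δ}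
    (hφ : Measurable (Function.uncurry φ)) (κ : Kernel α δ) (hκ : ∀ a, κ a = ν.map (φ a)) :
    (μ.prod ν).map (fun p => φ p.1 p.2) = μ.bind κ := by
  ext s hs
  have hφ' : Measurable fun p : α × β => φ p.1 p.2 := hφ
  rw [Measure.map_apply hφ' hs, Measure.prod_apply (hφ' hs),
    Measure.bind_apply hs κ.measurable.aemeasurable]
  refine lintegral_congr fun a => ?_
  rw [hκ, Measure.map_apply (f := φ a) (hφ.comp measurable_prodMk_left) hs]
  rfl

variable {Ω : Type*} [MeasurableSpace Ω] {P : Measure Ω} {Z : ℕ → Ω → EuclideanSpace ℝ (Fin d)}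

theorem measurable_chain (hZ_meas : ∀ k, 1 ≤ k → Measurable (Z k))
    (x : EuclideanSpace ℝ (Fin d)) (k : ℕ) : Measurable (chain U γ x Z k) := by
  induction k with
  | zero => exact measurable_const
  | succ k ih =>
    have h : Measurable fun ω => ∇ U (chain U γ x Z k ω) := (measurable_gradient U).comp ih
    have hz := hZ_meas (k + 1) (by omega)
    unfold chain
    fun_prop

theorem indepFun_chain (hZ_meas : ∀ k, 1 ≤ k → Measurable (Z k))
    (hZ_indep : iIndepFun (fun k => Z (k + 1)) P) (x : EuclideanSpace ℝ (Fin d)) (k : ℕ) :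
    IndepFun (chain U γ x Z k) (Z (k + 1)) P := by
  -- The independent family is indexed from `0`: index `i` stands for `Z (i + 1)`, so `range k`
  -- covers `Z_1, …, Z_k`.
  have h := hZ_indep.indepFun_finset (Finset.range k) {k} (by simp)
    fun i => hZ_meas (i + 1) (by omega)
  have hφ : Measurable fun w : Finset.range k → EuclideanSpace ℝ (Fin d) =>
      path U γ x k fun i => if h : i - 1 ∈ Finset.range k then w ⟨i - 1, h⟩ else 0 := by
    refine (measurable_path x k).comp (measurable_pi_lambda _ fun i => ?_)
    split_ifs <;> fun_prop
  have hψ : Measurable fun w : ({k} : Finset ℕ) → EuclideanSpace ℝ (Fin d) =>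
      w ⟨k, Finset.mem_singleton_self k⟩ := by fun_prop
  have hZ : Z (k + 1) = (fun w : ({k} : Finset ℕ) → EuclideanSpace ℝ (Fin d) =>
      w ⟨k, Finset.mem_singleton_self k⟩) ∘ fun a i => Z (i + 1) a := rfl
  rw [hZ]
  convert h.comp hφ hψ using 1
  funext ω
  refine chain_eq_path x Z ω k fun i h1 h2 => ?_
  have hi : i - 1 ∈ Finset.range k := by
    rw [Finset.mem_range]
    omega
  rw [dif_pos hi]
  simp only [Nat.sub_add_cancel h1]

variable [IsProbabilityMeasure P]

/-- Transfers the moment hypotheses, stated for the kernels `Q`, to the random variables `X_k`. -/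
theorem map_chain_eq_Q (hγ_pos : ∀ k, 1 ≤ k → 0 < γ k)
    (hZ_meas : ∀ k, 1 ≤ k → Measurable (Z k))
    (hZ_law : ∀ k, 1 ≤ k → HasLaw (Z k) (stdGaussian (EuclideanSpace ℝ (Fin d))) P)
    (hZ_indep : iIndepFun (fun k => Z (k + 1)) P) (x : EuclideanSpace ℝ (Fin d)) (k : ℕ) :
    P.map (chain U γ x Z k) = Q U γ 1 k x := by
  induction k with
  | zero =>
    change P.map (fun _ => x) = Kernel.id x
    rw [Measure.map_const, Kernel.id_apply, measure_univ, one_smul]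
  | succ k ih =>
    rw [Q, if_pos (by omega), Kernel.comp_apply, ← ih]
    have hX := measurable_chain (U := U) (γ := γ) hZ_meas x k
    have hZ := hZ_meas (k + 1) (by omega)
    have hpair := (indepFun_iff_map_prod_eq_prod_map_map hX.aemeasurable hZ.aemeasurable).1
      (indepFun_chain (U := U) (γ := γ) hZ_meas hZ_indep x k)
    rw [(hZ_law (k + 1) (by omega)).map_eq] at hpair
    have hφ : Measurable (Function.uncurry fun y z : EuclideanSpace ℝ (Fin d) =>
        y - γ (k + 1) • ∇ U y + √(2 * γ (k + 1)) • z) := by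
      have h : Measurable fun p : EuclideanSpace ℝ (Fin d) × EuclideanSpace ℝ (Fin d) =>
        ∇ U p.1 := (measurable_gradient U).comp measurable_fst
      unfold Function.uncurry
      fun_prop
    rw [← map_prod_eq_bind _ (stdGaussian (EuclideanSpace ℝ (Fin d))) hφ (R U (γ (k + 1)))
      fun a => R_apply_eq_map (hγ_pos (k + 1) (by omega)) a, ← hpair,
      Measure.map_map (show Measurable fun p : EuclideanSpace ℝ (Fin d) × EuclideanSpace ℝ (Fin d) =>
        p.1 - γ (k + 1) • ∇ U p.1 + √(2 * γ (k + 1)) • p.2 from hφ) (hX.prodMk hZ)]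
    rfl

theorem map_toLp_eq_stdGaussian (hZ_meas : ∀ k, 1 ≤ k → Measurable (Z k))
    (hZ_law : ∀ k, 1 ≤ k → HasLaw (Z k) (stdGaussian (EuclideanSpace ℝ (Fin d))) P)
    (hZ_indep : iIndepFun (fun k => Z (k + 1)) P) (M : ℕ) :
    P.map (fun ω => WithLp.toLp 2 fun i : Fin M => Z (i + 1) ω) =
      stdGaussian (PiLp 2 fun _ : Fin M => EuclideanSpace ℝ (Fin d)) := by
  have h := hZ_indep.precomp (g := fun i : Fin M => (i : ℕ)) Fin.val_injective
  have hm : ∀ i : Fin M, Measurable (Z (i + 1)) := fun i => hZ_meas _ (by omega)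
  rw [iIndepFun_iff_map_fun_eq_pi_map fun i => (hm i).aemeasurable] at h
  rw [← map_toLp_pi_stdGaussian]
  have e : ∀ i : Fin M, P.map (Z (i + 1)) = stdGaussian (EuclideanSpace ℝ (Fin d)) :=
    fun i => (hZ_law _ (by omega)).map_eq
  simp_rw [e] at h
  rw [← h, Measure.map_map (WithLp.measurable_toLp 2 _) (by fun_prop)]
  rfl

end Law

end ULA

/-! ### Variance of weighted sums of Lipschitz functionals. -/

namespace ProbabilityTheory

theorem lipschitzWith_sum_mul_comp {H E : Type*} [PseudoMetricSpace H] [PseudoMetricSpace E] 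
    {S : Finset ℕ} {Y : ℕ → H → E} (hY : ∀ k ∈ S, ∃ K, LipschitzWith K (Y k)) {f : E → ℝ} {Kf : NNReal}
    (hf : LipschitzWith Kf f) (w : ℕ → ℝ) :
    ∃ K, LipschitzWith K fun z => ∑ k ∈ S, w k * f (Y k z) := by
  choose! K hK using hY
  refine ⟨∑ k ∈ S, ‖w k‖₊ * (Kf * K k), LipschitzWith.of_dist_le_mul fun z z' => ?_⟩
  rw [Real.dist_eq, ← Finset.sum_sub_distrib, NNReal.coe_sum, Finset.sum_mul]
  refine (Finset.abs_sum_le_sum_abs _ _).trans (Finset.sum_le_sum fun k hk => ?_)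
  rw [← mul_sub, abs_mul, NNReal.coe_mul, mul_assoc]
  have := (hf.comp (hK k hk)).dist_le_mul z z'
  rw [Real.dist_eq] at this
  exact mul_le_mul_of_nonneg_left this (abs_nonneg _)

section WeightedSum

variable {E ι : Type*} [NormedAddCommGroup E] [InnerProductSpace ℝ E] [FiniteDimensional ℝ E]
  [MeasurableSpace E] [BorelSpace E] [Fintype ι]

/-- Variance bound for a weighted sum of functions of Lipschitz functionals of a family of
independent standard Gaussian vectors, in terms of the sensitivities `s k j` of the `k`-th
functional to the `j`-th vector. -/
theorem variance_sum_mul_comp_le [DecidableEq ι] {S : Finset ℕ}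
    {Y : ℕ → PiLp 2 (fun _ : ι => E) → E} (hY : ∀ k ∈ S, ∃ K, LipschitzWith K (Y k))
    {s : ℕ → ι → ℝ} (hs : ∀ k j, 0 ≤ s k j)
    (hYs : ∀ k ∈ S, ∀ z j u, ‖Y k (z + WithLp.toLp 2 (Pi.single j u)) - Y k z‖ ≤ s k j * ‖u‖)
    {f l : E → ℝ} {Kf : NNReal} (hf : LipschitzWith Kf f) (hl : Continuous l)
    (hl0 : ∀ x, 0 ≤ l x) (hfl : ∀ x y, |f y - f x| ≤ ‖y - x‖ * max (l x) (l y))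
    {w : ℕ → ℝ} (hw : ∀ k, 0 ≤ w k) {C : ℝ}
    (hlY : ∀ k ∈ S, MemLp (fun z => l (Y k z)) 2 (stdGaussian (PiLp 2 fun _ : ι => E)))
    (hC : ∀ k ∈ S, ∫ z, l (Y k z) ^ 2 ∂(stdGaussian (PiLp 2 fun _ : ι => E)) ≤ C) :
    Var[fun z => ∑ k ∈ S, w k * f (Y k z); stdGaussian (PiLp 2 fun _ : ι => E)] ≤
      C * ∑ j, (∑ k ∈ S, w k * s k j) ^ 2 := by
  set μ := stdGaussian (PiLp 2 fun _ : ι => E)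
  set F : PiLp 2 (fun _ : ι => E) → ℝ := fun z => ∑ k ∈ S, w k * f (Y k z) with hF
  obtain ⟨K, hK⟩ := lipschitzWith_sum_mul_comp hY hf w
  have hYc : ∀ k ∈ S, Continuous (Y k) := fun k hk => (hY k hk).choose_spec.continuous
  have hcoef : ∀ k j, 0 ≤ w k * s k j := fun k j => mul_nonneg (hw k) (hs k j)
  set G : ι → PiLp 2 (fun _ : ι => E) → ℝ := fun j z => ∑ k ∈ S, w k * s k j * l (Y k z) with hG
  -- Only `F` has to be differentiable at `z`; difference quotients avoid any derivative of `f` or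
  -- of the `Y k`.
  have hder : ∀ z, DifferentiableAt ℝ F z → ‖fderiv ℝ F z‖ ^ 2 ≤ ∑ j, G j z ^ 2 := by
    intro z hz
    refine sq_norm_le_sum_of_apply_single_le _ fun j u => ?_
    set v : PiLp 2 (fun _ : ι => E) := WithLp.toLp 2 (Pi.single j u)
    have hcont : ContinuousAt (fun t : ℝ => (∑ k ∈ S, w k * s k j *
        max (l (Y k z)) (l (Y k (z + t • v)))) * ‖u‖) 0 := by
      refine Continuous.continuousAt ((continuous_finsetSum _ fun k hk => ?_).mul
        continuous_const)
      exact continuous_const.mul (continuous_const.max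
        (hl.comp ((hYc k hk).comp (by fun_prop))))
    have h := abs_fderiv_apply_le (v := v) hz hcont fun t ht => ?_
    · simpa only [zero_smul, add_zero, max_self] using h
    · have e : F (z + t • v) - F z = ∑ k ∈ S, w k * (f (Y k (z + t • v)) - f (Y k z)) := by
        simp only [hF, mul_sub, Finset.sum_sub_distrib]
      rw [e, Finset.sum_mul, Finset.mul_sum]
      refine (Finset.abs_sum_le_sum_abs _ _).trans (Finset.sum_le_sum fun k hk => ?_)
      rw [abs_mul, abs_of_nonneg (hw k)]
      have h1 := hYs k hk z j (t • u)
      have ev : WithLp.toLp 2 (Pi.single j (t • u)) = t • v := by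
        rw [← WithLp.toLp_smul, ← Pi.single_smul]
      rw [ev, norm_smul, Real.norm_of_nonneg ht.le] at h1
      have h2 : 0 ≤ max (l (Y k z)) (l (Y k (z + t • v))) := (hl0 _).trans (le_max_left _ _)
      calc w k * |f (Y k (z + t • v)) - f (Y k z)|
          ≤ w k * (‖Y k (z + t • v) - Y k z‖ * max (l (Y k z)) (l (Y k (z + t • v)))) :=
            mul_le_mul_of_nonneg_left (hfl _ _) (hw k)
        _ ≤ w k * (s k j * (t * ‖u‖) * max (l (Y k z)) (l (Y k (z + t • v)))) :=
            mul_le_mul_of_nonneg_left (mul_le_mul_of_nonneg_right h1 h2) (hw k)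
        _ = _ := by ring
  have hGm : ∀ j, MemLp (G j) 2 μ := fun j =>
    memLp_finsetSum _ fun k hk => (hlY k hk).const_mul _
  have hGi : ∀ j, ∫ z, G j z ^ 2 ∂μ ≤ C * (∑ k ∈ S, w k * s k j) ^ 2 := by
    intro j
    have hli : ∀ k ∈ S, Integrable (fun z => w k * s k j * l (Y k z) ^ 2) μ := fun k hk =>
      (hlY k hk).integrable_sq.const_mul _
    calc ∫ z, G j z ^ 2 ∂μ
        ≤ ∫ z, (∑ k ∈ S, w k * s k j) * ∑ k ∈ S, w k * s k j * l (Y k z) ^ 2 ∂μ := by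
          refine integral_mono (hGm j).integrable_sq
            ((integrable_finsetSum _ hli).const_mul _) fun z => ?_
          -- Cauchy–Schwarz with the coefficients as weights: `(∑ a_k l_k)² ≤ (∑ a_k)(∑ a_k l_k²)`.
          exact Finset.sum_sq_le_sum_mul_sum_of_sq_le_mul _ (fun k _ => hcoef k j)
            (fun k _ => mul_nonneg (hcoef k j) (sq_nonneg _)) fun k _ => le_of_eq (by ring)
      _ = (∑ k ∈ S, w k * s k j) * ∑ k ∈ S, w k * s k j * ∫ z, l (Y k z) ^ 2 ∂μ := by
          rw [integral_const_mul, integral_finsetSum _ hli]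
          simp_rw [integral_const_mul]
      _ ≤ (∑ k ∈ S, w k * s k j) * ∑ k ∈ S, w k * s k j * C := by
          refine mul_le_mul_of_nonneg_left (Finset.sum_le_sum fun k hk => ?_)
            (Finset.sum_nonneg fun k _ => hcoef k j)
          exact mul_le_mul_of_nonneg_left (hC k hk) (hcoef k j)
      _ = _ := by
          rw [← Finset.sum_mul]
          ring
  calc Var[F; μ] ≤ ∫ z, ‖fderiv ℝ F z‖ ^ 2 ∂μ := variance_stdGaussian_le hK
    _ ≤ ∫ z, ∑ j, G j z ^ 2 ∂μ := by
        refine integral_mono_of_nonneg (Filter.Eventually.of_forall fun z => sq_nonneg _)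
          (integrable_finsetSum _ fun j _ => (hGm j).integrable_sq) ?_
        filter_upwards [stdGaussian_absolutelyContinuous.ae_le hK.ae_differentiableAt] with z hz
          using hder z hz
    _ = ∑ j, ∫ z, G j z ^ 2 ∂μ := integral_finsetSum _ fun j _ => (hGm j).integrable_sq
    _ ≤ _ := by
        rw [Finset.mul_sum]
        exact Finset.sum_le_sum fun j _ => hGi j

end WeightedSum

end ProbabilityTheory

/-! ### Summation of the squared sensitivities. -/

namespace ULA

theorem sum_mul_prod_one_sub_le {b : ℕ → ℝ} (hb1 : ∀ k, 1 ≤ k → b k ≤ 1)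
    {q : ℕ} (M : ℕ) :
    ∑ k ∈ Finset.Icc q M, b (k + 1) * ∏ i ∈ Finset.Ioc q k, (1 - b i) ≤ 1 := by
  have hnn : ∀ k, 0 ≤ ∏ i ∈ Finset.Ioc q k, (1 - b i) := fun k =>
    Finset.prod_nonneg fun i hi => by
      have := hb1 i (by have := (Finset.mem_Ioc.1 hi).1; omega)
      linarith
  rcases lt_or_ge M q with h | h
  · rw [Finset.Icc_eq_empty (by omega)]
    simp
  -- Each summand is the drop of the product from `k` to `k + 1`, so the sum telescopes.
  · have key : ∑ k ∈ Finset.Icc q M, b (k + 1) * ∏ i ∈ Finset.Ioc q k, (1 - b i) =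
        1 - ∏ i ∈ Finset.Ioc q (M + 1), (1 - b i) := by
      induction M, h using Nat.le_induction with
      | base => simp
      | succ n hn ih =>
        rw [Finset.sum_Icc_succ_top (by omega), ih,
          ← Finset.insert_Ioc_right_eq_Ioc_add_one (by omega : q ≤ n + 1),
          Finset.prod_insert (by simp)]
        ring
    rw [key]
    linarith [hnn (M + 1)]

theorem sum_mul_prod_Ioc_le {a : ℕ → ℝ} (ha0 : ∀ k, 1 ≤ k → 0 ≤ a k)
    (ha1 : ∀ k, 1 ≤ k → a k ≤ 1) (N : ℕ) :
    ∑ j ∈ Finset.Icc 1 N, a j * ∏ i ∈ Finset.Ioc j (N + 1), (1 - a i) ≤ 1 := by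
  -- The sums satisfy `S_{n+1} = (1 - a_{n+1}) S_n + a_{n+1}`, a convex combination of `S_n` and
  -- `1`.
  have key : ∀ n, ∑ j ∈ Finset.Icc 1 n, a j * ∏ i ∈ Finset.Ioc j n, (1 - a i) ≤ 1 := by
    intro n
    induction n with
    | zero => simp
    | succ n ih =>
      have e : ∑ j ∈ Finset.Icc 1 n, a j * ∏ i ∈ Finset.Ioc j (n + 1), (1 - a i) =
          (1 - a (n + 1)) * ∑ j ∈ Finset.Icc 1 n, a j * ∏ i ∈ Finset.Ioc j n, (1 - a i) := by
        rw [Finset.mul_sum]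
        refine Finset.sum_congr rfl fun j hj => ?_
        rw [← Finset.insert_Ioc_right_eq_Ioc_add_one (Finset.mem_Icc.1 hj).2,
          Finset.prod_insert (by simp)]
        ring
      rw [Finset.sum_Icc_succ_top (by omega), e]
      simp only [Finset.Ioc_self, Finset.prod_empty]
      nlinarith [ha0 (n + 1) (by omega), ha1 (n + 1) (by omega)]
  refine le_trans ?_ (key (N + 1))
  rw [Finset.sum_Icc_succ_top (by omega)]
  simp only [Finset.Ioc_self, Finset.prod_empty]
  linarith [ha0 (N + 1) (by omega)]

/-- The sum of the squared sensitivities of the (unnormalized) weighted average. -/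
theorem sum_sq_sensitivity_le {γ : ℕ → ℝ} {κ B : ℝ} (hκ : 0 < κ) (hγ_pos : ∀ k, 1 ≤ k → 0 < γ k)
    (hγ_anti : AntitoneOn γ (Set.Ici 1)) (hγB : γ 1 ≤ B) (hκγ : ∀ k, 1 ≤ k → κ * γ k ≤ 1)
    (N n : ℕ) :
    ∑ j ∈ Finset.Icc 1 (N + n), (∑ k ∈ Finset.Icc (N + 1) (N + n), γ (k + 1) *
      (if j ≤ k then √(2 * γ j) * ∏ i ∈ Finset.Ioc j k, √(1 - κ * γ i) else 0)) ^ 2 ≤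
      8 / κ ^ 2 * (κ⁻¹ + Gam γ (N + 2) (N + n + 1) + B) := by
  set c : ℕ → ℝ := fun i => √(1 - κ * γ i) with hc
  -- From `√(1 - u) ≤ 1 - u/2`: the contraction rate is halved, hence the `2 / κ` in `htail`.
  have hcb : ∀ i, 1 ≤ i → c i ≤ 1 - κ / 2 * γ i := fun i hi =>
    (Real.sqrt_le_left (by nlinarith [hκγ i hi])).2 (by nlinarith [sq_nonneg (κ * γ i)])
  have hc0 : ∀ i, 0 ≤ c i := fun i => Real.sqrt_nonneg _
  have hc2 : ∀ i, 1 ≤ i → c i ^ 2 = 1 - κ * γ i := fun i hi =>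
    Real.sq_sqrt (by linarith [hκγ i hi])
  have htail : ∀ q M : ℕ, ∑ k ∈ Finset.Icc q M, γ (k + 1) * ∏ i ∈ Finset.Ioc q k, c i ≤ 2 / κ := by
    intro q M
    have h := sum_mul_prod_one_sub_le (b := fun k => κ / 2 * γ k)
      (fun k hk => by nlinarith [hκγ k hk]) (q := q) M
    have h2 : κ / 2 * ∑ k ∈ Finset.Icc q M, γ (k + 1) * ∏ i ∈ Finset.Ioc q k, c i ≤ 1 := by
      refine le_trans ?_ h
      rw [Finset.mul_sum]
      refine Finset.sum_le_sum fun k _ => ?_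
      rw [← mul_assoc]
      refine mul_le_mul_of_nonneg_left (Finset.prod_le_prod (fun i _ => hc0 i) fun i hi => ?_)
        (by have := hγ_pos (k + 1) (by omega); positivity)
      exact hcb i (by have := (Finset.mem_Ioc.1 hi).1; omega)
    rw [le_div_iff₀ hκ]
    linarith
  set A : ℕ → ℝ := fun j => ∑ k ∈ Finset.Icc (N + 1) (N + n), γ (k + 1) *
    (if j ≤ k then ∏ i ∈ Finset.Ioc j k, c i else 0) with hA
  have hA0 : ∀ j, 0 ≤ A j := fun j => Finset.sum_nonneg fun k _ =>
    mul_nonneg (hγ_pos _ (by omega)).le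
      (by split_ifs; exacts [Finset.prod_nonneg fun i _ => hc0 i, le_rfl])
  have hA1 : ∀ j, N + 1 ≤ j → A j ≤ 2 / κ := by
    intro j hj
    refine le_trans (le_of_eq ?_) (htail j (N + n))
    rw [hA]
    simp only [mul_ite, mul_zero]
    rw [← Finset.sum_filter]
    refine Finset.sum_congr ?_ fun _ _ => rfl
    ext k
    simp only [Finset.mem_filter, Finset.mem_Icc]
    omega
  -- Noise from before the averaging window acts only through the state at time `N + 1`.
  have hA2 : ∀ j, j ≤ N → A j = (∏ i ∈ Finset.Ioc j (N + 1), c i) * A (N + 1) := by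
    intro j hj
    rw [hA]
    simp only [Finset.mul_sum]
    refine Finset.sum_congr rfl fun k hk => ?_
    have hk' := (Finset.mem_Icc.1 hk).1
    rw [if_pos (by omega), if_pos hk', ← Finset.Ioc_union_Ioc_eq_Ioc (by omega : j ≤ N + 1) hk',
      Finset.prod_union (Finset.Ioc_disjoint_Ioc_of_le le_rfl)]
    ring
  have hterm : ∀ j, 1 ≤ j → (∑ k ∈ Finset.Icc (N + 1) (N + n), γ (k + 1) *
      (if j ≤ k then √(2 * γ j) * ∏ i ∈ Finset.Ioc j k, c i else 0)) ^ 2 = 2 * γ j * A j ^ 2 := by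
    intro j hj
    have : ∑ k ∈ Finset.Icc (N + 1) (N + n), γ (k + 1) *
        (if j ≤ k then √(2 * γ j) * ∏ i ∈ Finset.Ioc j k, c i else 0) = √(2 * γ j) * A j := by
      rw [hA, Finset.mul_sum]
      refine Finset.sum_congr rfl fun k _ => ?_
      split_ifs <;> ring
    rw [this, mul_pow, Real.sq_sqrt (by have := hγ_pos j hj; positivity)]
  -- Squaring the products removes the square roots, and the second telescoping bound makes this
  -- contribution independent of `N`.
  have hlow : ∑ j ∈ Finset.Icc 1 N, 2 * γ j * A j ^ 2 ≤ 8 / κ ^ 2 * κ⁻¹ := by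
    have h := sum_mul_prod_Ioc_le (a := fun k => κ * γ k)
      (fun k hk => by have := hγ_pos k hk; positivity) hκγ N
    calc ∑ j ∈ Finset.Icc 1 N, 2 * γ j * A j ^ 2
        ≤ ∑ j ∈ Finset.Icc 1 N, 8 / κ ^ 2 * κ⁻¹ *
          (κ * γ j * ∏ i ∈ Finset.Ioc j (N + 1), (1 - κ * γ i)) := by
          refine Finset.sum_le_sum fun j hj => ?_
          obtain ⟨hj1, hjN⟩ := Finset.mem_Icc.1 hj
          have hp : (∏ i ∈ Finset.Ioc j (N + 1), c i) ^ 2 =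
              ∏ i ∈ Finset.Ioc j (N + 1), (1 - κ * γ i) := by
            rw [← Finset.prod_pow]
            exact Finset.prod_congr rfl fun i hi =>
              hc2 i (by have := (Finset.mem_Ioc.1 hi).1; omega)
          have hpn : 0 ≤ ∏ i ∈ Finset.Ioc j (N + 1), (1 - κ * γ i) := hp ▸ sq_nonneg _
          have hA4 : A (N + 1) ^ 2 ≤ (2 / κ) ^ 2 := pow_le_pow_left₀ (hA0 _) (hA1 _ le_rfl) 2
          have := hγ_pos j hj1
          rw [hA2 j hjN, mul_pow, hp]
          calc 2 * γ j * ((∏ i ∈ Finset.Ioc j (N + 1), (1 - κ * γ i)) * A (N + 1) ^ 2)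
              ≤ 2 * γ j * ((∏ i ∈ Finset.Ioc j (N + 1), (1 - κ * γ i)) * (2 / κ) ^ 2) := by
                gcongr
            _ = _ := by
                field_simp
                ring
      _ ≤ 8 / κ ^ 2 * κ⁻¹ * 1 := by
          rw [← Finset.mul_sum]
          gcongr
      _ = _ := mul_one _
  have hhigh : ∑ j ∈ Finset.Icc (N + 1) (N + n), 2 * γ j * A j ^ 2 ≤
      8 / κ ^ 2 * (Gam γ (N + 2) (N + n + 1) + B) := by
    -- The noise at time `j` carries `γ j` while the weights use `γ (k + 1)`; the index shift costs
    -- one step size, at most `B`.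
    have hsum : ∑ j ∈ Finset.Icc (N + 1) (N + n), γ j ≤ Gam γ (N + 2) (N + n + 1) + B := by
      have h1 : ∑ j ∈ Finset.Icc (N + 1) (N + n + 1), γ j = γ (N + 1)
          + Gam γ (N + 2) (N + n + 1) := by
        rw [Gam, ← Finset.insert_Icc_add_one_left_eq_Icc (by omega : N + 1 ≤ N + n + 1),
          Finset.sum_insert (by simp)]
        rfl
      rw [Finset.sum_Icc_succ_top (by omega)] at h1
      have h2 : γ (N + 1) ≤ γ 1 := hγ_anti (by simp) (by simp) (by omega)
      linarith [hγ_pos (N + n + 1) (by omega)]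
    calc ∑ j ∈ Finset.Icc (N + 1) (N + n), 2 * γ j * A j ^ 2
        ≤ ∑ j ∈ Finset.Icc (N + 1) (N + n), 8 / κ ^ 2 * γ j := by
          refine Finset.sum_le_sum fun j hj => ?_
          have hj1 := (Finset.mem_Icc.1 hj).1
          have hA4 : A j ^ 2 ≤ (2 / κ) ^ 2 := pow_le_pow_left₀ (hA0 _) (hA1 _ hj1) 2
          have := hγ_pos j (by omega)
          calc 2 * γ j * A j ^ 2 ≤ 2 * γ j * (2 / κ) ^ 2 := by gcongr
            _ = _ := by ring
      _ ≤ _ := by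
          rw [← Finset.mul_sum]
          gcongr
  have hsplit : ∑ j ∈ Finset.Icc 1 (N + n), 2 * γ j * A j ^ 2 =
      ∑ j ∈ Finset.Icc 1 N, 2 * γ j * A j ^ 2
        + ∑ j ∈ Finset.Icc (N + 1) (N + n), 2 * γ j * A j ^ 2 := by
    rw [← Finset.sum_union]
    · refine Finset.sum_congr ?_ fun _ _ => rfl
      ext j
      simp only [Finset.mem_union, Finset.mem_Icc]
      omega
    · rw [Finset.disjoint_left]
      intro j hj hj'
      simp only [Finset.mem_Icc] at hj hj'
      omega
  rw [Finset.sum_congr rfl fun j hj => hterm j (Finset.mem_Icc.1 hj).1, hsplit]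
  linarith

end ULA

/-! ### The variance bound for Lipschitz `f`. -/

namespace ULA

variable {d : ℕ} {U : EuclideanSpace ℝ (Fin d) → ℝ} {m L : ℝ} {γ : ℕ → ℝ}

/-- A finite noise vector `(z_1, …, z_M)`, extended by zero. -/
noncomputable def extend {E : Type*} [Zero E] {M : ℕ} (z : PiLp 2 fun _ : Fin M => E) (i : ℕ) : E :=
  if h : 1 ≤ i ∧ i ≤ M then z ⟨i - 1, by omega⟩ else 0

theorem extend_succ {E : Type*} [Zero E] {M : ℕ} (z : PiLp 2 fun _ : Fin M => E) (j : Fin M) :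
    extend z (j + 1) = z j := by
  rw [extend, dif_pos ⟨by omega, j.2⟩]
  rfl

theorem norm_extend_sub_le {E : Type*} [NormedAddCommGroup E] {M : ℕ}
    (z w : PiLp 2 fun _ : Fin M => E) (i : ℕ) : ‖extend z i - extend w i‖ ≤ ‖z - w‖ := by
  unfold extend
  split_ifs
  · exact PiLp.norm_apply_le (z - w) _
  · simp

theorem extend_add_single_of_ne {E : Type*} [NormedAddCommGroup E] {M : ℕ}
    (z : PiLp 2 fun _ : Fin M => E) (j : Fin M) (u : E) {i : ℕ} (hi : i ≠ j + 1) :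
    extend (z + WithLp.toLp 2 (Pi.single j u)) i = extend z i := by
  unfold extend
  split_ifs with h
  · have : (⟨i - 1, by omega⟩ : Fin M) ≠ j := fun h' => hi (by
      rw [← h']
      simp only
      omega)
    simp only [PiLp.add_apply, Pi.single_eq_of_ne this, add_zero]
  · rfl

section Canonical

variable {c : ℕ → ℝ}
  (hc : ∀ k, 1 ≤ k → ∀ a b : EuclideanSpace ℝ (Fin d),
    ‖(a - γ k • ∇ U a) - (b - γ k • ∇ U b)‖ ≤ c k * ‖a - b‖)

include hc

theorem exists_lipschitzWith_path_extend (hc1 : ∀ k, 1 ≤ k → c k ≤ 1)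
    (x : EuclideanSpace ℝ (Fin d)) (M k : ℕ) :
    ∃ K, LipschitzWith K fun z : PiLp 2 (fun _ : Fin M => EuclideanSpace ℝ (Fin d)) =>
      path U γ x k (extend z) := by
  refine ⟨Real.toNNReal (∑ i ∈ Finset.Icc 1 k, √(2 * γ i)),
    LipschitzWith.of_dist_le_mul fun z w => ?_⟩
  rw [dist_eq_norm, dist_eq_norm, Real.coe_toNNReal _ (Finset.sum_nonneg fun _ _ =>
    Real.sqrt_nonneg _), Finset.sum_mul]
  refine (norm_path_sub_le hc hc1 x _ _ k).trans (Finset.sum_le_sum fun i _ => ?_)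
  exact mul_le_mul_of_nonneg_left (norm_extend_sub_le z w i) (Real.sqrt_nonneg _)

theorem norm_path_extend_add_single_sub_le (hc0 : ∀ k, 0 ≤ c k) (x : EuclideanSpace ℝ (Fin d))
    {M : ℕ} (k : ℕ) (z : PiLp 2 fun _ : Fin M => EuclideanSpace ℝ (Fin d)) (j : Fin M)
    (u : EuclideanSpace ℝ (Fin d)) :
    ‖path U γ x k (extend (z + WithLp.toLp 2 (Pi.single j u))) - path U γ x k (extend z)‖ ≤
      (if (j : ℕ) + 1 ≤ k then √(2 * γ (j + 1)) * ∏ i ∈ Finset.Ioc ((j : ℕ) + 1) k, c i else 0)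
        * ‖u‖ := by
  have h := norm_path_sub_le_of_eq_off hc hc0 x (j := (j : ℕ) + 1) (by omega)
    (fun i hi => extend_add_single_of_ne z j u hi) k
  rw [extend_succ, extend_succ] at h
  simpa using h

end Canonical

theorem norm_gradientStep_sub_le (hm : 0 < m) (hmL : m ≤ L) (hL : GradientLipschitz U L)
    (hU : StronglyConvex U m) {g : ℝ} (hg0 : 0 ≤ g) (hg : g ≤ 2 / (m + L))
    (x y : EuclideanSpace ℝ (Fin d)) :
    ‖(x - g • ∇ U x) - (y - g • ∇ U y)‖ ≤ √(1 - kappa m L * g) * ‖x - y‖ := by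
  refine le_of_sq_le_sq ?_ (by positivity)
  rw [mul_pow, Real.sq_sqrt (by linarith [kappa_mul_le_one hm hmL hg])]
  exact sq_norm_gradientStep_sub_le hm hmL hL hU hg0 hg x y

theorem chain_eq_path_extend {Ω : Type*} {Z : ℕ → Ω → EuclideanSpace ℝ (Fin d)}
    (x : EuclideanSpace ℝ (Fin d)) {M k : ℕ}
    (hk : k ≤ M) (ω : Ω) :
    chain U γ x Z k ω = path U γ x k (extend (WithLp.toLp 2 fun i : Fin M => Z (i + 1) ω)) := by
  refine chain_eq_path x Z ω k fun i h1 h2 => ?_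
  rw [extend, dif_pos ⟨h1, h2.trans hk⟩]
  simp only [Nat.sub_add_cancel h1]

variable {Ω : Type*} [MeasurableSpace Ω] {P : Measure Ω} [IsProbabilityMeasure P]
  {Z : ℕ → Ω → EuclideanSpace ℝ (Fin d)}

theorem variance_estimator_le_of_lipschitz (hm : 0 < m) (hmL : m ≤ L)
    (hL : GradientLipschitz U L) (hU : StronglyConvex U m)
    (hγ_pos : ∀ k, 1 ≤ k → 0 < γ k) (hγ_anti : AntitoneOn γ (Set.Ici 1))
    (hγ_le : γ 1 ≤ 2 / (m + L)) (hZ_meas : ∀ k, 1 ≤ k → Measurable (Z k))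
    (hZ_law : ∀ k, 1 ≤ k → HasLaw (Z k) (stdGaussian (EuclideanSpace ℝ (Fin d))) P)
    (hZ_indep : iIndepFun (fun k => Z (k + 1)) P)
    (x : EuclideanSpace ℝ (Fin d)) {N n : ℕ} (hn : 1 ≤ n)
    {f l : EuclideanSpace ℝ (Fin d) → ℝ} {Kf : NNReal} (hf : LipschitzWith Kf f)
    (hl : Continuous l) (hl0 : ∀ x, 0 ≤ l x)
    (hfl : ∀ x y, |f y - f x| ≤ ‖y - x‖ * max (l x) (l y)) {C : ℝ} (hC0 : 0 ≤ C)
    (hlX : ∀ k ∈ Finset.Icc (N + 1) (N + n), MemLp (fun ω => l (chain U γ x Z k ω)) 2 P)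
    (hC : ∀ k ∈ Finset.Icc (N + 1) (N + n), ∫ ω, l (chain U γ x Z k ω) ^ 2 ∂P ≤ C) :
    Var[estimator γ f (chain U γ x Z) N n; P] ≤
      8 * C / (kappa m L ^ 2 * Gam γ (N + 2) (N + n + 1)) *
          (1 + (Gam γ (N + 2) (N + n + 1))⁻¹ * ((kappa m L)⁻¹ + 2 / (m + L))) := by
  set κ := kappa m L
  set Γ := Gam γ (N + 2) (N + n + 1) with hΓ
  have hΓ_pos : 0 < Γ := Finset.sum_pos
    (fun k hk => hγ_pos k (by have := (Finset.mem_Icc.1 hk).1; omega))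
    (Finset.nonempty_Icc.2 (by omega))
  have hκ : 0 < κ := kappa_pos hm hmL
  have hγ_le' : ∀ k, 1 ≤ k → γ k ≤ 2 / (m + L) := fun k hk =>
    (hγ_anti (Set.mem_Ici.2 le_rfl) (Set.mem_Ici.2 hk) hk).trans hγ_le
  have hκγ : ∀ k, 1 ≤ k → κ * γ k ≤ 1 := fun k hk => kappa_mul_le_one hm hmL (hγ_le' k hk)
  have hc : ∀ k, 1 ≤ k → ∀ a b : EuclideanSpace ℝ (Fin d),
      ‖(a - γ k • ∇ U a) - (b - γ k • ∇ U b)‖ ≤ √(1 - κ * γ k) * ‖a - b‖ := fun k hk =>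
    norm_gradientStep_sub_le hm hmL hL hU (hγ_pos k hk).le (hγ_le' k hk)
  have hc0 : ∀ k, 0 ≤ √(1 - κ * γ k) := fun k => Real.sqrt_nonneg _
  have hc1 : ∀ k, 1 ≤ k → √(1 - κ * γ k) ≤ 1 := fun k hk =>
    Real.sqrt_le_one.2 (by nlinarith [hγ_pos k hk])
  set S := Finset.Icc (N + 1) (N + n)
  set W : Ω → PiLp 2 (fun _ : Fin (N + n) => EuclideanSpace ℝ (Fin d)) :=
    fun ω => WithLp.toLp 2 fun i : Fin (N + n) => Z (i + 1) ω
  have hWm : Measurable W := (WithLp.measurable_toLp 2 _).comp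
    (measurable_pi_lambda _ fun i => hZ_meas _ (by omega))
  have hW : P.map W = stdGaussian _ := map_toLp_eq_stdGaussian hZ_meas hZ_law hZ_indep (N + n)
  set Y : ℕ → PiLp 2 (fun _ : Fin (N + n) => EuclideanSpace ℝ (Fin d)) →
    EuclideanSpace ℝ (Fin d) := fun k z => path U γ x k (extend z)
  have hYL : ∀ k, ∃ K, LipschitzWith K (Y k) := exists_lipschitzWith_path_extend hc hc1 x (N + n)
  have hYc : ∀ k, Continuous (Y k) := fun k => (hYL k).choose_spec.continuous
  have hX : ∀ k ∈ S, ∀ ω, chain U γ x Z k ω = Y k (W ω) := fun k hk ω =>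
    chain_eq_path_extend x (Finset.mem_Icc.1 hk).2 ω
  set w : ℕ → ℝ := fun k => γ (k + 1) * Γ⁻¹
  have hw : ∀ k, 0 ≤ w k := fun k => mul_nonneg (hγ_pos _ (by omega)).le (inv_nonneg.2 hΓ_pos.le)
  have hest : estimator γ f (chain U γ x Z) N n = (fun z => ∑ k ∈ S, w k * f (Y k z)) ∘ W := by
    funext ω
    exact Finset.sum_congr rfl fun k hk => by rw [hX k hk]
  have hFc : Continuous fun z => ∑ k ∈ S, w k * f (Y k z) :=
    continuous_finsetSum _ fun k _ => continuous_const.mul (hf.continuous.comp (hYc k))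
  have hlYc : ∀ k, Continuous fun z => l (Y k z) := fun k => hl.comp (hYc k)
  rw [hest, ← variance_map hFc.aemeasurable hWm.aemeasurable, hW]
  have hmain := variance_sum_mul_comp_le (S := S) (Y := Y) (fun k _ => hYL k)
    (s := fun k j => if (j : ℕ) + 1 ≤ k then
      √(2 * γ (j + 1)) * ∏ i ∈ Finset.Ioc ((j : ℕ) + 1) k, √(1 - κ * γ i) else 0)
    (fun k j => by
      split_ifs
      exacts [mul_nonneg (Real.sqrt_nonneg _) (Finset.prod_nonneg fun i _ => hc0 i), le_rfl])
    (fun k _ z j u => norm_path_extend_add_single_sub_le hc hc0 x k z j u)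
    hf hl hl0 hfl hw (C := C)
    (fun k hk => by
      rw [← hW, memLp_map_measure_iff (hlYc k).aestronglyMeasurable hWm.aemeasurable]
      exact (memLp_congr_ae (Filter.Eventually.of_forall fun ω => by
        simp only [Function.comp_apply, hX k hk])).1 (hlX k hk))
    (fun k hk => by
      have h2 : Continuous fun z => l (Y k z) ^ 2 := (hlYc k).pow 2
      rw [← hW, integral_map hWm.aemeasurable h2.aestronglyMeasurable]
      simp_rw [← hX k hk]
      exact hC k hk)
  refine hmain.trans ?_
  have hsens := sum_sq_sensitivity_le hκ hγ_pos hγ_anti hγ_le hκγ N n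
  rw [← hΓ] at hsens
  have hre : ∑ j : Fin (N + n), (∑ k ∈ S, w k * (if (j : ℕ) + 1 ≤ k then
      √(2 * γ (j + 1)) * ∏ i ∈ Finset.Ioc ((j : ℕ) + 1) k, √(1 - κ * γ i) else 0)) ^ 2 =
      Γ⁻¹ ^ 2 * ∑ j ∈ Finset.Icc 1 (N + n), (∑ k ∈ S, γ (k + 1) * (if j ≤ k then
        √(2 * γ j) * ∏ i ∈ Finset.Ioc j k, √(1 - κ * γ i) else 0)) ^ 2 := by
    -- Coordinate `j` of the Gaussian vector is `Z (j + 1)`, so the sum is shifted to start at `1`;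
    -- the weights also release `Γ⁻¹`, squared.
    rw [Finset.mul_sum, Fin.sum_univ_eq_sum_range (fun j => (∑ k ∈ S, w k * (if j + 1 ≤ k then
      √(2 * γ (j + 1)) * ∏ i ∈ Finset.Ioc (j + 1) k, √(1 - κ * γ i) else 0)) ^ 2) (N + n),
      Finset.range_eq_Ico, Finset.sum_Ico_add' (fun j => (∑ k ∈ S, w k * (if j ≤ k then
      √(2 * γ j) * ∏ i ∈ Finset.Ioc j k, √(1 - κ * γ i) else 0)) ^ 2) 0 (N + n) 1]
    refine Finset.sum_congr (by ext; simp) fun j _ => ?_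
    rw [← mul_pow, Finset.mul_sum]
    congr 1
    exact Finset.sum_congr rfl fun k _ => by ring
  rw [hre]
  calc C * (Γ⁻¹ ^ 2 * _) ≤ C * (Γ⁻¹ ^ 2 * (8 / κ ^ 2 * (κ⁻¹ + Γ + 2 / (m + L)))) := by
        gcongr
    _ = _ := by
        field_simp
        ring

end ULA

/-! ### Truncation of locally Lipschitz functions. -/

namespace ULA

section Truncation

variable {E : Type*} [NormedAddCommGroup E]

theorem continuous_of_abs_sub_le {f l : E → ℝ} (hl : Continuous l)
    (hfl : ∀ x y, |f y - f x| ≤ ‖y - x‖ * max (l x) (l y)) : Continuous f := by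
  refine continuous_iff_continuousAt.2 fun x => tendsto_iff_norm_sub_tendsto_zero.2 ?_
  have h : Continuous fun y => ‖y - x‖ * max (l x) (l y) := by fun_prop
  have h' := h.tendsto x
  rw [sub_self, norm_zero, zero_mul] at h'
  exact squeeze_zero (fun _ => norm_nonneg _) (fun y => hfl x y) h'

/-- A `1 / R`-Lipschitz cutoff which is `1` on the ball of radius `R` and vanishes outside the ball
of radius `2 R`. -/
noncomputable def cutoff (R : ℝ) (x : E) : ℝ := max 0 (min 1 (2 - ‖x‖ / R))

theorem cutoff_nonneg (R : ℝ) (x : E) : 0 ≤ cutoff R x := le_max_left _ _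

theorem cutoff_le_one (R : ℝ) (x : E) : cutoff R x ≤ 1 := max_le zero_le_one (min_le_left _ _)

theorem cutoff_eq_one {R : ℝ} (hR : 0 < R) {x : E} (hx : ‖x‖ ≤ R) : cutoff R x = 1 := by
  have : ‖x‖ / R ≤ 1 := (div_le_one hR).2 hx
  rw [cutoff, min_eq_left (by linarith), max_eq_right zero_le_one]

theorem cutoff_eq_zero {R : ℝ} (hR : 0 < R) {x : E} (hx : 2 * R ≤ ‖x‖) : cutoff R x = 0 := by
  have : 2 ≤ ‖x‖ / R := (le_div_iff₀ hR).2 hx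
  exact max_eq_left ((min_le_right _ _).trans (by linarith))

theorem abs_cutoff_sub_le {R : ℝ} (hR : 0 < R) (x y : E) :
    |cutoff R y - cutoff R x| ≤ ‖y - x‖ / R := by
  have h : LipschitzWith (Real.toNNReal R⁻¹) fun x : E => 2 - ‖x‖ / R := by
    refine LipschitzWith.of_dist_le_mul fun x y => ?_
    rw [Real.coe_toNNReal _ (inv_nonneg.2 hR.le), dist_sub_left, Real.dist_eq, ← sub_div, abs_div,
      abs_of_pos hR, dist_eq_norm, div_eq_inv_mul]
    exact mul_le_mul_of_nonneg_left (abs_norm_sub_norm_le x y) (inv_nonneg.2 hR.le)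
  have h2 := ((h.const_min 1).const_max 0).dist_le_mul y x
  rwa [Real.coe_toNNReal _ (inv_nonneg.2 hR.le), Real.dist_eq, dist_eq_norm, ← div_eq_inv_mul] at h2

theorem abs_cutoff_mul_sub_le {f l : E → ℝ}
    (hfl : ∀ x y, |f y - f x| ≤ ‖y - x‖ * max (l x) (l y)) {R : ℝ} (hR : 0 < R) (x y : E) :
    |cutoff R y * f y - cutoff R x * f x| ≤ ‖y - x‖ * (max (l x) (l y) + |f x| / R) := by
  have e : cutoff R y * f y - cutoff R x * f x =
      cutoff R y * (f y - f x) + (cutoff R y - cutoff R x) * f x := by ring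
  have h1 : |cutoff R y * (f y - f x)| ≤ ‖y - x‖ * max (l x) (l y) := by
    rw [abs_mul, abs_of_nonneg (cutoff_nonneg R y)]
    exact (mul_le_of_le_one_left (abs_nonneg _) (cutoff_le_one R y)).trans (hfl x y)
  have h2 : |(cutoff R y - cutoff R x) * f x| ≤ ‖y - x‖ / R * |f x| := by
    rw [abs_mul]
    exact mul_le_mul_of_nonneg_right (abs_cutoff_sub_le hR x y) (abs_nonneg _)
  rw [e]
  refine (abs_add_le _ _).trans ((add_le_add h1 h2).trans (le_of_eq ?_))
  ring

/-- The product rule may charge `|f| / R` to either endpoint; charging it to the one with the larger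
`l` gives a modulus of the required `max` form. -/
theorem abs_cutoff_mul_sub_le_max {f l : E → ℝ}
    (hfl : ∀ x y, |f y - f x| ≤ ‖y - x‖ * max (l x) (l y)) {R : ℝ} (hR : 0 < R) (x y : E) :
    |cutoff R y * f y - cutoff R x * f x| ≤
      ‖y - x‖ * max (l x + |f x| / R) (l y + |f y| / R) := by
  have h1 := abs_cutoff_mul_sub_le hfl hR x y
  have h2 := abs_cutoff_mul_sub_le hfl hR y x
  rw [abs_sub_comm, norm_sub_rev] at h2
  rcases le_total (l x) (l y) with h | h
  · refine h2.trans (mul_le_mul_of_nonneg_left ?_ (norm_nonneg _))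
    rw [max_eq_left h]
    exact le_max_right _ _
  · refine h1.trans (mul_le_mul_of_nonneg_left ?_ (norm_nonneg _))
    rw [max_eq_left h]
    exact le_max_left _ _

/-- On the closed ball of radius `2R` both `f` and `l` are bounded by compactness. A point outside
needs no bound on `f` or `l`, as the cutoff vanishes there. -/
theorem exists_lipschitzWith_cutoff_mul [ProperSpace E] {f l : E → ℝ} (hl : Continuous l)
    (hl0 : ∀ x, 0 ≤ l x) (hfl : ∀ x y, |f y - f x| ≤ ‖y - x‖ * max (l x) (l y)) {R : ℝ}
    (hR : 0 < R) : ∃ K, LipschitzWith K fun x => cutoff R x * f x := by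
  have hfc := continuous_of_abs_sub_le hl hfl
  obtain ⟨A, hA⟩ := (isCompact_closedBall (0 : E) (2 * R)).exists_bound_of_continuousOn
    hl.continuousOn
  obtain ⟨B, hB⟩ := (isCompact_closedBall (0 : E) (2 * R)).exists_bound_of_continuousOn
    hfc.continuousOn
  have hA' : ∀ x : E, ‖x‖ ≤ 2 * R → l x ≤ A := fun x hx =>
    (le_abs_self _).trans (hA x (mem_closedBall_zero_iff.2 hx))
  have hB' : ∀ x : E, ‖x‖ ≤ 2 * R → |f x| ≤ B := fun x hx => hB x (mem_closedBall_zero_iff.2 hx)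
  have hA0 : 0 ≤ A := (hl0 0).trans (hA' 0 (by simpa using hR.le))
  have hB0 : 0 ≤ B := (abs_nonneg _).trans (hB' 0 (by simpa using hR.le))
  have hin : ∀ x y : E, ‖x‖ ≤ 2 * R →
      |cutoff R y * f y - cutoff R x * f x| ≤ (A + B / R) * ‖y - x‖ := by
    intro x y hx
    rcases le_total ‖y‖ (2 * R) with hy | hy
    · refine (abs_cutoff_mul_sub_le hfl hR x y).trans ?_
      rw [mul_comm]
      have := max_le (hA' x hx) (hA' y hy)
      have := hB' x hx
      gcongr
    · have e : cutoff R y * f y - cutoff R x * f x = (cutoff R y - cutoff R x) * f x := by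
        rw [cutoff_eq_zero hR hy]
        ring
      rw [e, abs_mul]
      calc |cutoff R y - cutoff R x| * |f x| ≤ ‖y - x‖ / R * B := by
            gcongr
            exacts [abs_cutoff_sub_le hR x y, hB' x hx]
        _ = B / R * ‖y - x‖ := by ring
        _ ≤ _ := by
            gcongr
            linarith
  refine ⟨Real.toNNReal (A + B / R), LipschitzWith.of_dist_le_mul fun x y => ?_⟩
  rw [Real.coe_toNNReal _ (by positivity), Real.dist_eq, dist_eq_norm]
  rcases le_total ‖x‖ (2 * R) with hx | hx
  · rw [abs_sub_comm, norm_sub_rev]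
    exact hin x y hx
  · rcases le_total ‖y‖ (2 * R) with hy | hy
    · exact hin y x hy
    · rw [cutoff_eq_zero hR hx, cutoff_eq_zero hR hy]
      simp only [zero_mul, sub_self, abs_zero]
      positivity

end Truncation

/-! ### Integrability along the chain. -/

variable {d : ℕ} {U : EuclideanSpace ℝ (Fin d) → ℝ} {m L : ℝ} {γ : ℕ → ℝ}
  {Ω : Type*} [MeasurableSpace Ω] {P : Measure Ω} [IsProbabilityMeasure P]
  {Z : ℕ → Ω → EuclideanSpace ℝ (Fin d)}
  {f lip : EuclideanSpace ℝ (Fin d) → ℝ} {ε Cπ : ℝ} {CQ CQε : EuclideanSpace ℝ (Fin d) → ℝ}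

theorem memLp_norm_chain_sub (hm : 0 < m) (hmL : m ≤ L)
    (hL : GradientLipschitz U L) (hU : StronglyConvex U m)
    (hγ_pos : ∀ k, 1 ≤ k → 0 < γ k) (hγ_le : ∀ k, 1 ≤ k → γ k ≤ 2 / (m + L))
    (hZ_meas : ∀ k, 1 ≤ k → Measurable (Z k))
    (hZ_law : ∀ k, 1 ≤ k → HasLaw (Z k) (stdGaussian (EuclideanSpace ℝ (Fin d))) P)
    (hZ_indep : iIndepFun (fun k => Z (k + 1)) P)
    (x : EuclideanSpace ℝ (Fin d)) (k : ℕ) {p : ℝ≥0∞} (hp : p ≠ ∞) :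
    MemLp (fun ω => ‖chain U γ x Z k ω - x‖) p P := by
  have hκ : 0 < kappa m L := kappa_pos hm hmL
  obtain ⟨K, hK⟩ := exists_lipschitzWith_path_extend
    (fun k hk => norm_gradientStep_sub_le hm hmL hL hU (hγ_pos k hk).le (hγ_le k hk))
    (fun k hk => Real.sqrt_le_one.2 (by nlinarith [hγ_pos k hk])) x k k
  have hK' : LipschitzWith K fun z : PiLp 2 (fun _ : Fin k => EuclideanSpace ℝ (Fin d)) =>
      ‖path U γ x k (extend z) - x‖ := by
    refine LipschitzWith.of_dist_le_mul fun z w => (le_trans ?_ (hK.dist_le_mul z w))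
    rw [Real.dist_eq, dist_eq_norm]
    refine (abs_norm_sub_norm_le _ _).trans (le_of_eq ?_)
    rw [sub_sub_sub_cancel_right]
  have h := memLp_of_lipschitzWith hK' p hp
  have hWm : Measurable fun ω => WithLp.toLp 2 fun i : Fin k => Z (i + 1) ω :=
    (WithLp.measurable_toLp 2 _).comp (measurable_pi_lambda _ fun i => hZ_meas _ (by omega))
  rw [← map_toLp_eq_stdGaussian hZ_meas hZ_law hZ_indep k,
    memLp_map_measure_iff hK'.continuous.aestronglyMeasurable hWm.aemeasurable] at h
  refine (memLp_congr_ae (Filter.Eventually.of_forall fun ω => ?_)).1 h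
  simp only [Function.comp_apply, chain_eq_path_extend x le_rfl]

theorem lintegral_comp_chain (hγ_pos : ∀ k, 1 ≤ k → 0 < γ k)
    (hZ_meas : ∀ k, 1 ≤ k → Measurable (Z k))
    (hZ_law : ∀ k, 1 ≤ k → HasLaw (Z k) (stdGaussian (EuclideanSpace ℝ (Fin d))) P)
    (hZ_indep : iIndepFun (fun k => Z (k + 1)) P) (x : EuclideanSpace ℝ (Fin d)) (k : ℕ)
    {g : EuclideanSpace ℝ (Fin d) → ℝ≥0∞} (hg : Measurable g) :
    ∫⁻ ω, g (chain U γ x Z k ω) ∂P = ∫⁻ y, g y ∂(Q U γ 1 k x) := by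
  rw [← map_chain_eq_Q hγ_pos hZ_meas hZ_law hZ_indep x k,
    lintegral_map hg (measurable_chain hZ_meas x k)]

theorem memLp_lip_chain (hf : LocLipMoment U γ f lip ε Cπ CQ CQε)
    (hγ_pos : ∀ k, 1 ≤ k → 0 < γ k) (hZ_meas : ∀ k, 1 ≤ k → Measurable (Z k))
    (hZ_law : ∀ k, 1 ≤ k → HasLaw (Z k) (stdGaussian (EuclideanSpace ℝ (Fin d))) P)
    (hZ_indep : iIndepFun (fun k => Z (k + 1)) P) (x : EuclideanSpace ℝ (Fin d)) {k : ℕ}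
    (hk : 1 ≤ k) :
    MemLp (fun ω => lip (chain U γ x Z k ω)) (ENNReal.ofReal (2 * (1 + ε))) P := by
  have hε := hf.ε_pos
  refine ⟨(hf.lip_continuous.measurable.comp (measurable_chain hZ_meas x k)).aestronglyMeasurable,
    ?_⟩
  have hp : 0 < 2 * (1 + ε) := by positivity
  rw [eLpNorm_lt_top_iff_lintegral_rpow_enorm_lt_top (by simpa using hp) ENNReal.ofReal_ne_top,
    ENNReal.toReal_ofReal hp.le]
  have e : ∀ ω, ‖lip (chain U γ x Z k ω)‖ₑ ^ (2 * (1 + ε)) =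
      ENNReal.ofReal (lip (chain U γ x Z k ω) ^ (2 * (1 + ε))) := fun ω => by
    rw [Real.enorm_eq_ofReal (hf.lip_nonneg _), ENNReal.ofReal_rpow_of_nonneg (hf.lip_nonneg _) hp.le]
  simp_rw [e]
  have hmeas : Measurable fun y => ENNReal.ofReal (lip y ^ (2 * (1 + ε))) :=
    (hf.lip_continuous.measurable.pow_const _).ennreal_ofReal
  rw [lintegral_comp_chain hγ_pos hZ_meas hZ_law hZ_indep x k hmeas]
  exact (hf.Q_moment_ε x 1 k hk).trans_lt ENNReal.ofReal_lt_top

theorem integral_sq_lip_chain_le (hf : LocLipMoment U γ f lip ε Cπ CQ CQε)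
    (hγ_pos : ∀ k, 1 ≤ k → 0 < γ k) (hZ_meas : ∀ k, 1 ≤ k → Measurable (Z k))
    (hZ_law : ∀ k, 1 ≤ k → HasLaw (Z k) (stdGaussian (EuclideanSpace ℝ (Fin d))) P)
    (hZ_indep : iIndepFun (fun k => Z (k + 1)) P) (x : EuclideanSpace ℝ (Fin d)) {k : ℕ}
    (hk : 1 ≤ k) : ∫ ω, lip (chain U γ x Z k ω) ^ 2 ∂P ≤ CQ x := by
  have hmeas : Measurable fun y => lip y ^ 2 := hf.lip_continuous.measurable.pow_const _
  rw [integral_eq_lintegral_of_nonneg_ae (Filter.Eventually.of_forall fun ω => sq_nonneg _)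
    (hmeas.comp (measurable_chain hZ_meas x k)).aestronglyMeasurable,
    lintegral_comp_chain hγ_pos hZ_meas hZ_law hZ_indep x k hmeas.ennreal_ofReal]
  exact ENNReal.toReal_le_of_le_ofReal (hf.CQ_nonneg x) (hf.Q_moment x 1 k hk)

/-- By the local Lipschitz bound `|f(X_k)|` is at most `|f x| + (lip x + lip(X_k)) ‖X_k - x‖`. The
displacement is a Lipschitz function of Gaussians and has all moments, so slightly more than two
moments of `lip(X_k)` suffice by Hölder. -/
theorem memLp_comp_chain (hm : 0 < m) (hmL : m ≤ L)
    (hL : GradientLipschitz U L) (hU : StronglyConvex U m)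
    (hγ_pos : ∀ k, 1 ≤ k → 0 < γ k) (hγ_le : ∀ k, 1 ≤ k → γ k ≤ 2 / (m + L))
    (hf : LocLipMoment U γ f lip ε Cπ CQ CQε)
    (hZ_meas : ∀ k, 1 ≤ k → Measurable (Z k))
    (hZ_law : ∀ k, 1 ≤ k → HasLaw (Z k) (stdGaussian (EuclideanSpace ℝ (Fin d))) P)
    (hZ_indep : iIndepFun (fun k => Z (k + 1)) P)
    (x : EuclideanSpace ℝ (Fin d)) {k : ℕ} (hk : 1 ≤ k) :
    MemLp (fun ω => f (chain U γ x Z k ω)) 2 P := by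
  have hε := hf.ε_pos
  have hlip := memLp_lip_chain hf hγ_pos hZ_meas hZ_law hZ_indep x hk
  have hN : ∀ p : ℝ≥0∞, p ≠ ∞ → MemLp (fun ω => ‖chain U γ x Z k ω - x‖) p P := fun p hp =>
    memLp_norm_chain_sub hm hmL hL hU hγ_pos hγ_le hZ_meas hZ_law hZ_indep x k hp
  -- The exponents satisfy `1/(2(1+ε)) + ε/(2(1+ε)) = 1/2`.
  have htri : Real.HolderTriple (2 * (1 + ε)) (2 * (1 + ε) / ε) 2 :=
    ⟨by field_simp, by positivity, by positivity⟩
  have htri' := htri.ennrealOfReal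
  rw [ENNReal.ofReal_ofNat] at htri'
  have hprod : MemLp (fun ω => lip (chain U γ x Z k ω) * ‖chain U γ x Z k ω - x‖) 2 P :=
    MemLp.mul' (hN (ENNReal.ofReal (2 * (1 + ε) / ε)) ENNReal.ofReal_ne_top) hlip
  have hdom : MemLp (fun ω => |f x| + (lip x * ‖chain U γ x Z k ω - x‖
      + lip (chain U γ x Z k ω) * ‖chain U γ x Z k ω - x‖)) 2 P :=
    (memLp_const |f x|).add (((hN 2 (by simp)).const_mul (lip x)).add hprod)
  have hfc := continuous_of_abs_sub_le hf.lip_continuous hf.abs_sub_le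
  refine hdom.of_le (hfc.measurable.comp (measurable_chain hZ_meas x k)).aestronglyMeasurable
    (Filter.Eventually.of_forall fun ω => ?_)
  set y := chain U γ x Z k ω
  have h1 := hf.abs_sub_le x y
  have h2 := hf.lip_nonneg x
  have h3 := hf.lip_nonneg y
  have h4 : max (lip x) (lip y) ≤ lip x + lip y := max_le (by linarith) (by linarith)
  have h5 := mul_le_mul_of_nonneg_left h4 (norm_nonneg (y - x))
  rw [Real.norm_eq_abs, Real.norm_of_nonneg (by positivity)]
  linarith [abs_sub_abs_le_abs_sub (f y) (f x)]

end ULA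

/-! ### Removal of the cutoff and conclusion. -/

namespace ULA

open Filter Topology

theorem tendsto_variance_of_dominated {Ω : Type*} [MeasurableSpace Ω] {P : Measure Ω}
    [IsProbabilityMeasure P] {X : ℕ → Ω → ℝ} {Y D : Ω → ℝ} (hX : ∀ i, AEStronglyMeasurable (X i) P)
    (hD : MemLp D 2 P) (hXD : ∀ i ω, |X i ω| ≤ D ω)
    (hlim : ∀ ω, Tendsto (fun i => X i ω) atTop (𝓝 (Y ω))) :
    Tendsto (fun i => Var[X i; P]) atTop (𝓝 (Var[Y; P])) := by
  have hY : AEStronglyMeasurable Y P :=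
    aestronglyMeasurable_of_tendsto_ae atTop hX (Eventually.of_forall hlim)
  have hYD : ∀ ω, |Y ω| ≤ D ω := fun ω =>
    le_of_tendsto (hlim ω).abs (Eventually.of_forall fun i => hXD i ω)
  have hle : ∀ {W : Ω → ℝ}, AEStronglyMeasurable W P → (∀ ω, |W ω| ≤ D ω) → MemLp W 2 P :=
    fun hW hWD => hD.of_le hW (Eventually.of_forall fun ω =>
      (hWD ω).trans (le_abs_self _))
  have h1 : Tendsto (fun i => ∫ ω, X i ω ∂P) atTop (𝓝 (∫ ω, Y ω ∂P)) :=
    tendsto_integral_of_dominated_convergence D hX (hD.integrable (by simp))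
      (fun i => Eventually.of_forall (hXD i)) (Eventually.of_forall hlim)
  have h2 : Tendsto (fun i => ∫ ω, X i ω ^ 2 ∂P) atTop (𝓝 (∫ ω, Y ω ^ 2 ∂P)) :=
    tendsto_integral_of_dominated_convergence (fun ω => D ω ^ 2) (fun i => (hX i).pow 2)
      hD.integrable_sq
      (fun i => Eventually.of_forall fun ω => by
        rw [norm_pow]
        exact pow_le_pow_left₀ (norm_nonneg _) (hXD i ω) 2)
      (Eventually.of_forall fun ω => (hlim ω).pow 2)
  simp_rw [fun i => variance_eq_sub (hle (hX i) (hXD i)), variance_eq_sub (hle hY hYD)]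
  exact h2.sub (h1.pow 2)

/-- Young's inequality `2ab / R ≤ (a² + b²) / R`, weighted so that the coefficients tend to `1` and
`0` as `R → ∞`; the sharp constant `CQ x` thus survives the limit. -/
theorem add_div_sq_le {a b R : ℝ} (hR : 0 < R) :
    (a + b / R) ^ 2 ≤ (1 + R⁻¹) * a ^ 2 + (1 + R) / R ^ 2 * b ^ 2 := by
  have h : 0 ≤ R * (a / R - b / R) ^ 2 := by positivity
  have e : (1 + R⁻¹) * a ^ 2 + (1 + R) / R ^ 2 * b ^ 2 - (a + b / R) ^ 2 =
      R * (a / R - b / R) ^ 2 := by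
    field_simp
    ring
  linarith

end ULA

theorem mainTheorem11 {d : ℕ} (hd : 1 ≤ d) (U : EuclideanSpace ℝ (Fin d) → ℝ) (m L : ℝ)
    (hL : ULA.GradientLipschitz U L) (hm : 0 < m) (hU : ULA.StronglyConvex U m)
    (γ : ℕ → ℝ) (hγ_pos : ∀ k, 1 ≤ k → 0 < γ k) (hγ_anti : AntitoneOn γ (Set.Ici 1))
    (hγ_le : γ 1 ≤ 2 / (m + L))
    (f lip : EuclideanSpace ℝ (Fin d) → ℝ) (ε Cπ : ℝ)
    (CQ CQε : EuclideanSpace ℝ (Fin d) → ℝ)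
    (hf : ULA.LocLipMoment U γ f lip ε Cπ CQ CQε)
    {Ω : Type*} [MeasurableSpace Ω] (P : Measure Ω) [IsProbabilityMeasure P]
    (Z : ℕ → Ω → EuclideanSpace ℝ (Fin d))
    (hZ_meas : ∀ k, 1 ≤ k → Measurable (Z k))
    (hZ_law : ∀ k, 1 ≤ k → HasLaw (Z k) (stdGaussian (EuclideanSpace ℝ (Fin d))) P)
    (hZ_indep : iIndepFun (fun k => Z (k + 1)) P)
    (x : EuclideanSpace ℝ (Fin d)) (N n : ℕ) (hn : 1 ≤ n) :
    MemLp (ULA.estimator γ f (ULA.chain U γ x Z) N n) 2 P ∧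
      variance (ULA.estimator γ f (ULA.chain U γ x Z) N n) P ≤
        8 * CQ x / (ULA.kappa m L ^ 2 * ULA.Gam γ (N + 2) (N + n + 1)) *
          (1 + (ULA.Gam γ (N + 2) (N + n + 1))⁻¹ * ((ULA.kappa m L)⁻¹ + 2 / (m + L))) := by
  have hmL := ULA.le_of_gradientLipschitz_of_stronglyConvex hd hL hU
  have hγ_le' : ∀ k, 1 ≤ k → γ k ≤ 2 / (m + L) := fun k hk =>
    (hγ_anti (Set.mem_Ici.2 le_rfl) (Set.mem_Ici.2 hk) hk).trans hγ_le
  have hfc := ULA.continuous_of_abs_sub_le hf.lip_continuous hf.abs_sub_le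
  set X := ULA.chain U γ x Z
  set S := Finset.Icc (N + 1) (N + n)
  set Γ := ULA.Gam γ (N + 2) (N + n + 1)
  have hΓ0 : 0 ≤ Γ := Finset.sum_nonneg fun k hk =>
    (hγ_pos k (by have := (Finset.mem_Icc.1 hk).1; omega)).le
  have hXm : ∀ k, Measurable (X k) := ULA.measurable_chain hZ_meas x
  have hS1 : ∀ k ∈ S, 1 ≤ k := fun k hk => by
    have := (Finset.mem_Icc.1 hk).1
    omega
  have hfX : ∀ k ∈ S, MemLp (fun ω => f (X k ω)) 2 P := fun k hk =>
    ULA.memLp_comp_chain hm hmL hL hU hγ_pos hγ_le' hf hZ_meas hZ_law hZ_indep x (hS1 k hk)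
  have hw0 : ∀ k, 0 ≤ γ (k + 1) * Γ⁻¹ := fun k =>
    mul_nonneg (hγ_pos _ (by omega)).le (inv_nonneg.2 hΓ0)
  refine ⟨memLp_finsetSum _ fun k hk => (hfX k hk).const_mul _, ?_⟩
  have hlipX : ∀ k ∈ S, MemLp (fun ω => lip (X k ω)) 2 P := fun k hk =>
    (ULA.memLp_lip_chain hf hγ_pos hZ_meas hZ_law hZ_indep x (hS1 k hk)).mono_exponent (by
      rw [← ENNReal.ofReal_ofNat]
      exact ENNReal.ofReal_le_ofReal (by linarith [hf.ε_pos]))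
  -- A crude bound, uniform over `S` and independent of the cutoff radius; its coefficient tends to
  -- `0`.
  set B := ∑ k ∈ S, ∫ ω, f (X k ω) ^ 2 ∂P
  have hB : ∀ k ∈ S, ∫ ω, f (X k ω) ^ 2 ∂P ≤ B := fun k hk =>
    Finset.single_le_sum (f := fun k => ∫ ω, f (X k ω) ^ 2 ∂P)
      (fun _ _ => integral_nonneg fun _ => sq_nonneg _) hk
  have hB0 : 0 ≤ B := Finset.sum_nonneg fun _ _ => integral_nonneg fun _ => sq_nonneg _
  have hCQ := hf.CQ_nonneg x
  set bound : ℝ → ℝ := fun C => 8 * C / (ULA.kappa m L ^ 2 * Γ) *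
    (1 + Γ⁻¹ * ((ULA.kappa m L)⁻¹ + 2 / (m + L))) with hbound
  have htrunc : ∀ i : ℕ, Var[ULA.estimator γ
      (fun y => ULA.cutoff ((i : ℝ) + 1) y * f y) X N n; P] ≤
      bound ((1 + ((i : ℝ) + 1)⁻¹) * CQ x + (1 + ((i : ℝ) + 1)) / ((i : ℝ) + 1) ^ 2 * B) := by
    intro i
    have hR : 0 < (i : ℝ) + 1 := by positivity
    set R := (i : ℝ) + 1
    obtain ⟨K, hK⟩ := ULA.exists_lipschitzWith_cutoff_mul hf.lip_continuous hf.lip_nonneg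
      hf.abs_sub_le hR
    have hlR : ∀ k ∈ S, MemLp (fun ω => lip (X k ω) + |f (X k ω)| / R) 2 P := fun k hk => by
      simp_rw [div_eq_mul_inv]
      exact (hlipX k hk).add ((hfX k hk).abs.mul_const _)
    refine ULA.variance_estimator_le_of_lipschitz hm hmL hL hU hγ_pos hγ_anti hγ_le hZ_meas hZ_law
      hZ_indep x hn hK (l := fun y => lip y + |f y| / R)
      (hf.lip_continuous.add (hfc.abs.div_const _))
      (fun y => by have := hf.lip_nonneg y; positivity)
      (ULA.abs_cutoff_mul_sub_le_max hf.abs_sub_le hR) (by positivity) hlR fun k hk => ?_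
    have i1 : Integrable (fun ω => (1 + R⁻¹) * lip (X k ω) ^ 2) P :=
      (hlipX k hk).integrable_sq.const_mul _
    have i2 : Integrable (fun ω => (1 + R) / R ^ 2 * f (X k ω) ^ 2) P :=
      (hfX k hk).integrable_sq.const_mul _
    calc ∫ ω, (lip (X k ω) + |f (X k ω)| / R) ^ 2 ∂P
        ≤ ∫ ω, ((1 + R⁻¹) * lip (X k ω) ^ 2 + (1 + R) / R ^ 2 * f (X k ω) ^ 2) ∂P := by
          refine integral_mono (hlR k hk).integrable_sq (i1.add i2) fun ω => ?_
          have := ULA.add_div_sq_le (a := lip (X k ω)) (b := |f (X k ω)|) hR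
          rwa [sq_abs] at this
      _ = (1 + R⁻¹) * ∫ ω, lip (X k ω) ^ 2 ∂P + (1 + R) / R ^ 2 * ∫ ω, f (X k ω) ^ 2 ∂P := by
          rw [integral_add i1 i2, integral_const_mul, integral_const_mul]
      _ ≤ _ := by
          gcongr
          · exact ULA.integral_sq_lip_chain_le hf hγ_pos hZ_meas hZ_law hZ_indep x (hS1 k hk)
          · exact hB k hk
  have hvar : Filter.Tendsto (fun i : ℕ => Var[ULA.estimator γ
      (fun y => ULA.cutoff ((i : ℝ) + 1) y * f y) X N n; P]) Filter.atTop
      (nhds (Var[ULA.estimator γ f X N n; P])) := by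
    refine ULA.tendsto_variance_of_dominated (D := fun ω => ∑ k ∈ S, γ (k + 1) * Γ⁻¹ * |f (X k ω)|)
      (fun i => ?_) (memLp_finsetSum _ fun k hk => (hfX k hk).abs.const_mul _) (fun i ω => ?_)
      fun ω => ?_
    · obtain ⟨K, hK⟩ := ULA.exists_lipschitzWith_cutoff_mul hf.lip_continuous hf.lip_nonneg
        hf.abs_sub_le (R := (i : ℝ) + 1) (by positivity)
      exact (Finset.measurable_sum _ fun k _ =>
        (hK.continuous.measurable.comp (hXm k)).const_mul _).aestronglyMeasurable
    · refine (Finset.abs_sum_le_sum_abs _ _).trans (Finset.sum_le_sum fun k _ => ?_)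
      change |γ (k + 1) * Γ⁻¹ * (ULA.cutoff ((i : ℝ) + 1) (X k ω) * f (X k ω))| ≤ _
      rw [abs_mul, abs_of_nonneg (hw0 k), abs_mul, abs_of_nonneg (ULA.cutoff_nonneg _ _)]
      exact mul_le_mul_of_nonneg_left
        (mul_le_of_le_one_left (abs_nonneg _) (ULA.cutoff_le_one _ _)) (hw0 k)
    · refine tendsto_finsetSum _ fun k _ => ?_
      refine tendsto_const_nhds.congr' ?_
      -- Once the radius exceeds `‖X k ω‖` the cutoff equals `1` there, so each summand is
      -- eventually constant in `i`.
      filter_upwards [Filter.eventually_ge_atTop ⌈‖X k ω‖⌉₊] with i hi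
      have h : ‖X k ω‖ ≤ (i : ℝ) + 1 := by
        have := (Nat.le_ceil ‖X k ω‖).trans (Nat.cast_le.2 hi)
        linarith
      rw [ULA.cutoff_eq_one (by positivity) h, one_mul]
  have hinv : Filter.Tendsto (fun i : ℕ => ((i : ℝ) + 1)⁻¹) Filter.atTop (nhds 0) := by
    simpa using tendsto_one_div_add_atTop_nhds_zero_nat (𝕜 := ℝ)
  have hconst : Filter.Tendsto (fun i : ℕ => (1 + ((i : ℝ) + 1)⁻¹) * CQ x
      + (1 + ((i : ℝ) + 1)) / ((i : ℝ) + 1) ^ 2 * B) Filter.atTop (nhds (CQ x)) := by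
    have h : Filter.Tendsto (fun i : ℕ => (1 + ((i : ℝ) + 1)⁻¹) * CQ x
        + (((i : ℝ) + 1)⁻¹ ^ 2 + ((i : ℝ) + 1)⁻¹) * B) Filter.atTop
        (nhds ((1 + 0) * CQ x + (0 ^ 2 + 0) * B)) :=
      ((hinv.const_add 1).mul_const _).add (((hinv.pow 2).add hinv).mul_const _)
    norm_num only [add_zero, one_mul, zero_mul] at h
    refine h.congr fun i => ?_
    have hR : (i : ℝ) + 1 ≠ 0 := by positivity
    congr 2
    field_simp
  have hbc : Continuous bound := by
    rw [hbound]
    fun_prop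
  exact le_of_tendsto_of_tendsto hvar ((hbc.tendsto _).comp hconst) (Filter.Eventually.of_forall htrunc)
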